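/- Define rational numbers $B(d_1,\dots,d_n)$ ($n\ge1$, $d_j\ge0$) recursively by $B(0)=\frac18$ and $$B(d,d_1,\dots,d_n)=\sum_{i=1}^n(2d_i+1)\,B(d_1,\dots,d_i+d,\dots,d_n)+\frac12\sum_{\substack{a+b=d-1\\a,b\ge0}}\Bigl(B(a,b,d_1,\dots,d_n)+\sum_{I\sqcup J=\{1,\dots,n\}}B(a,d_I)\,B(b,d_J)\Bigr)$$ for $n\ge0$, $d\ge0$, $(d,d_1,\dots,d_n)\ne(0)$. The Brézin–Gross–Witten (BGW) numbers are $\langle\tau_{d_1}\cdots\tau_{d_n}\rangle^\Theta_g=B(d_1,\dots,d_n)/\prod_j(2d_j+1)!!$, where $g=d_1+\dots+d_n+1$. The normalized BGW numbers are $$C(d_1,\dots,d_n)=\frac{2^{2g-1}\prod_{j=1}^n(2d_j+1)!!}{(X-1)!}\,\langle\tau_{d_1}\cdots\tau_{d_n}\rangle^\Theta_g,\qquad X=X(d_1,\dots,d_n)=\sum_{j=1}^n(2d_j+1)=2g-2+n.$$ Let $n\ge1$ and let $\lambda=(\lambda_1,\dots,\lambda_{n-1})$ be a fixed tuple of positive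 integers, $|\lambda|=\sum_j\lambda_j$. There are polynomials $P_\lambda,Q_\lambda,\widetilde Q_\lambda$ in one variable with coefficients in $\mathbb Z[1/2]$, with $P_\lambda$ monic and $Q_\lambda(g)=P_\lambda(2g-2+n)$, such that the following hold. 1. If $n\ge2$, then $P_\lambda$ has degree $\sum_{j=1}^{n-1}(2\lambda_j+1)+\delta_{n,2}-2$, and for every integer $d_n\ge0$, with $X=X(\lambda,d_n)$, $$C(\lambda,d_n)=\frac{1}{X^{\delta_{n,2}}\,(X-1)!}\;\frac{(2d_n+1)!!^3}{2^{d_n+1}\,d_n!}\;P_\lambda(X).$$ 2. For every integer $g\ge|\lambda|+1$ one has $C(g-1)\ne0$ and $$\frac{C(\lambda,g-1-|\lambda|)}{C(g-1)}=\frac{Q_\lambda(g)}{\prod_{j=1}^{n-3}(2g+j)}\prod_{i=1}^{|\lambda|}\frac{2g-2i}{(2g-2i+1)^3},$$ where $\prod_{j=1}^{n-3}$ is $1$ for $n\le3$. 3. For every integer $g\ge|\lambda|+2$, $$\frac{C(\lambda,g-1-|\lambda|)}{C(g-1)}=\frac{\widetilde Q_\lambda(g)}{(2g-2|\lambda|-2)_{2|\lambda|+n}\,\prod_{i=1}^{|\lambda|}(2g-2i+1)^2},$$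 where $(a)_b=a(a+1)\cdots(a+b-1)$. -/

import Mathlib

open scoped Nat

namespace BGW

/-- `X(d₁,…,dₙ) = ∑ⱼ (2dⱼ+1)`. -/
def X (ds : List ℕ) : ℕ := (ds.map fun d => 2 * d + 1).sum

/-- The genus `g(d₁,…,dₙ) = d₁+⋯+dₙ+1`. -/
def genus (ds : List ℕ) : ℕ := ds.sum + 1

/-- For a tuple `ds = (d₁,…,dₙ)` and a set of indices `I`, the subtuple `(dᵢ)_{i ∈ I}`
(in the order inherited from `ds`). -/
def restrict (ds : List ℕ) (I : Finset (Fin ds.length)) : List ℕ :=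
  ((List.finRange ds.length).filter fun i => i ∈ I).map ds.get

theorem X_cons (d : ℕ) (ds : List ℕ) : X (d :: ds) = 2 * d + 1 + X ds := by
  simp [X]

theorem X_restrict_le (ds : List ℕ) (I : Finset (Fin ds.length)) : X (restrict ds I) ≤ X ds := by
  have h : (restrict ds I).Sublist ds := by
    have h1 := (List.filter_sublist (p := fun i => decide (i ∈ I))
      (l := List.finRange ds.length)).map ds.get
    rwa [List.map_get_finRange] at h1
  exact (h.map fun d => 2 * d + 1).sum_le_sum (by simp)

theorem X_set (d : ℕ) (ds : List ℕ) (i : Fin ds.length) :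
    X (ds.set i (ds.get i + d)) = X ds + 2 * d := by
  induction ds with
  | nil => exact i.elim0
  | cons e es ih =>
    refine Fin.cases ?_ (fun j => ?_) i
    · simp [X_cons]; ring
    · have := ih j
      simp only [List.get_eq_getElem] at this
      simp [X_cons, this]; ring

/-- The numbers `B(d₁,…,dₙ)`, `n ≥ 1`, defined by `B(0) = 1/8` and the
Dijkgraaf–Verlinde–Verlinde-type relation (equivalent to the Virasoro constraints)
`B(d, d₁,…,dₙ) = ∑ᵢ (2dᵢ+1) B(d₁,…,dᵢ+d,…,dₙ)
  + ½ ∑_{a+b=d-1} ( B(a,b,d₁,…,dₙ) + ∑_{I ⊔ J = {1,…,n}} B(a,d_I) B(b,d_J) )`,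
by recursion on `X`. The value `0` at the empty tuple is a convention and is never used. -/
def B : List ℕ → ℚ
  | [] => 0
  | [0] => 1 / 8
  | d :: ds =>
      ∑ i : Fin ds.length, (2 * (ds.get i : ℚ) + 1) * B (ds.set i (ds.get i + d))
      + 1 / 2 * ∑ a : Fin d,
          (B ((a : ℕ) :: (d - 1 - a) :: ds)
            + ∑ I : Finset (Fin ds.length),
                B ((a : ℕ) :: restrict ds I) * B ((d - 1 - a) :: restrict ds Iᶜ))
termination_by ds => X ds
decreasing_by
  · rw [X_set, X_cons]; omega
  · simp only [X_cons]; omega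
  · have := X_restrict_le ds I
    simp only [X_cons]; omega
  · have := X_restrict_le ds Iᶜ
    simp only [X_cons]; omega

/-- The Brézin–Gross–Witten number `⟨τ_{d₁} ⋯ τ_{dₙ}⟩^Θ_g`, `g = d₁+⋯+dₙ+1`, which is
`B(d₁,…,dₙ) / ∏ⱼ (2dⱼ+1)!!`. -/
def number (ds : List ℕ) : ℚ := B ds / (ds.map fun d => ((2 * d + 1)‼ : ℚ)).prod

/-- The normalized BGW number
`C(d₁,…,dₙ) = 2^{2g-1} ∏ⱼ (2dⱼ+1)!! / (X-1)! · ⟨τ_{d₁} ⋯ τ_{dₙ}⟩^Θ_g`. -/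
def C (ds : List ℕ) : ℚ :=
  2 ^ (2 * genus ds - 1) * (ds.map fun d => ((2 * d + 1)‼ : ℚ)).prod / ((X ds - 1)! : ℚ)
    * number ds

/-- The ring `ℤ[1/2]`, as a subring of `ℚ`. -/
abbrev ZHalf : Subalgebra ℤ ℚ := Algebra.adjoin ℤ {(1 / 2 : ℚ)}

end BGW

/-! ### Convolution algebra of correlators and its derivations. -/

namespace BGW

/-! The recursion singles out its first argument. The crux is that `B` is symmetric: only then can
the recursion be applied to an entry of λ while d = d_n stays a spectator. Symmetry comes from
linearising. The linear Virasoro constraints on disconnected correlators are compatible because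
their operators close under commutation (`Corr.vir_swap`), so removing entries in any order gives
the same solution. Its logarithm satisfies the quadratic recursion that determines `B`
(`B_eq_conn`).

Removing an entry l of λ replaces d by d+l and multiplies by 2d+1, up to terms of lower weight.
Iterating ends in one-point numbers, which have a closed form (`Corr.one_point`). Hence B(d,λ) is
(2d+1)!!³/4^(d+1) times a polynomial in 2d over (2d+2K)!! for some K, with leading coefficient
2^(-2|λ|) (`isAsymp_extd`).

The spurious factors (2d+2)⋯(2d+2K) are removed by continuing d to negative integers. The recursion
survives there with a few unstable values (`Corr.extd_cons`), and vanishing at every negative d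
forces the numerator to be divisible by these factors (`IsAsymp.exists_polynomial`). With a single
other entry k one unstable value survives, at d = -1-k; the factor X kills it, which explains
δ_{n,2}. The power 2^(2g-1) makes the polynomial monic. The quotient formulas follow on dividing by
C(g-1) and comparing explicit products. -/

/-- Rational-valued functions of finite multisets of natural numbers, with the convolution product
(exponential generating series in the times `t₀, t₁, …`). -/
def Corr : Type := Multiset ℕ → ℚ

namespace Corr

instance : AddCommGroup Corr := inferInstanceAs (AddCommGroup (Multiset ℕ → ℚ))

instance : Module ℚ Corr := inferInstanceAs (Module ℚ (Multiset ℕ → ℚ))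

/-- The value of a correlator at a multiset. -/
def ev (f : Corr) (S : Multiset ℕ) : ℚ := f S

@[ext] theorem ext {f g : Corr} (h : ∀ S, f.ev S = g.ev S) : f = g := funext h

@[simp] theorem ev_add (f g : Corr) (S : Multiset ℕ) : (f + g).ev S = f.ev S + g.ev S := rfl
@[simp] theorem ev_sub (f g : Corr) (S : Multiset ℕ) : (f - g).ev S = f.ev S - g.ev S := rfl
@[simp] theorem ev_zero (S : Multiset ℕ) : (0 : Corr).ev S = 0 := rfl
@[simp] theorem ev_smul (c : ℚ) (f : Corr) (S : Multiset ℕ) : (c • f).ev S = c * f.ev S := rfl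

theorem ev_sum {ι : Type*} (s : Finset ι) (f : ι → Corr) (S : Multiset ℕ) :
    (∑ i ∈ s, f i).ev S = ∑ i ∈ s, (f i).ev S :=
  map_sum (AddMonoidHom.mk' (fun f : Corr => f.ev S) fun _ _ => rfl) f s

/-- The derivative with respect to the time `t_d`. -/
def der (d : ℕ) : Corr →ₗ[ℚ] Corr where
  toFun f := fun S => f.ev (d ::ₘ S)
  map_add' _ _ := rfl
  map_smul' _ _ := rfl

@[simp] theorem ev_der (d : ℕ) (f : Corr) (S : Multiset ℕ) :
    (der d f).ev S = f.ev (d ::ₘ S) := rfl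

theorem der_comm (a b : ℕ) (f : Corr) : der a (der b f) = der b (der a f) := by
  ext S; simp [Multiset.cons_swap]

/-- The convolution product. -/
def conv (f g : Corr) : Corr :=
  fun S => ((Multiset.antidiagonal S).map fun p => f.ev p.1 * g.ev p.2).sum

theorem ev_conv (f g : Corr) (S : Multiset ℕ) :
    (conv f g).ev S = ((Multiset.antidiagonal S).map fun p => f.ev p.1 * g.ev p.2).sum := rfl

theorem conv_add (f g h : Corr) : conv f (g + h) = conv f g + conv f h := by
  ext S; simp [ev_conv, mul_add]

theorem add_conv (f g h : Corr) : conv (f + g) h = conv f h + conv g h := by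
  ext S; simp [ev_conv, add_mul]

theorem ev_conv_zero (f g : Corr) : (conv f g).ev 0 = f.ev 0 * g.ev 0 := by
  simp [ev_conv]

theorem der_conv (d : ℕ) (f g : Corr) :
    der d (conv f g) = conv (der d f) g + conv f (der d g) := by
  ext S
  simp [ev_conv, Multiset.antidiagonal_cons, add_comm]

theorem ev_conv_cons (d : ℕ) (f g : Corr) (S : Multiset ℕ) :
    (conv f g).ev (d ::ₘ S) = (conv (der d f) g).ev S + (conv f (der d g)).ev S := by
  rw [← ev_der, der_conv, ev_add]

theorem conv_comm' (f g : Corr) : conv f g = conv g f := by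
  ext S
  induction S using Multiset.induction generalizing f g with
  | empty => simp [ev_conv_zero, mul_comm]
  | cons d S ih => rw [ev_conv_cons, ev_conv_cons, ih, ih f]; ring

theorem conv_assoc' (f g h : Corr) : conv (conv f g) h = conv f (conv g h) := by
  ext S
  induction S using Multiset.induction generalizing f g h with
  | empty => simp [ev_conv_zero, mul_assoc]
  | cons d S ih =>
    rw [ev_conv_cons, ev_conv_cons, der_conv, der_conv, add_conv, conv_add, ev_add, ev_add,
      ih, ih, ih]
    ring

/-- The unit of the convolution product. -/
def unit : Corr := fun S => if S = 0 then 1 else 0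

theorem ev_unit_zero : unit.ev 0 = 1 := rfl

theorem der_unit (d : ℕ) : der d unit = 0 := by
  ext S
  change (if d ::ₘ S = 0 then (1 : ℚ) else 0) = 0
  simp

theorem zero_conv (g : Corr) : conv 0 g = 0 := by
  ext S; simp [ev_conv]

theorem unit_conv (f : Corr) : conv unit f = f := by
  ext S
  induction S using Multiset.induction generalizing f with
  | empty => rw [ev_conv_zero, ev_unit_zero, one_mul]
  | cons d S ih => rw [ev_conv_cons, der_unit, ih, zero_conv]; simp

instance : CommRing Corr where
  __ := (inferInstance : AddCommGroup Corr)
  mul := conv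
  one := unit
  left_distrib := conv_add
  right_distrib := add_conv
  zero_mul := zero_conv
  mul_zero f := (conv_comm' f 0).trans (zero_conv f)
  mul_assoc := conv_assoc'
  one_mul := unit_conv
  mul_one f := (conv_comm' f unit).trans (unit_conv f)
  mul_comm := conv_comm'

theorem ev_mul (f g : Corr) (S : Multiset ℕ) :
    (f * g).ev S = ((Multiset.antidiagonal S).map fun p => f.ev p.1 * g.ev p.2).sum := rfl

@[simp] theorem ev_mul_zero (f g : Corr) : (f * g).ev 0 = f.ev 0 * g.ev 0 := ev_conv_zero f g

theorem der_mul (d : ℕ) (f g : Corr) : der d (f * g) = der d f * g + f * der d g :=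
  der_conv d f g

theorem ev_mul_cons (d : ℕ) (f g : Corr) (S : Multiset ℕ) :
    (f * g).ev (d ::ₘ S) = (der d f * g).ev S + (f * der d g).ev S := ev_conv_cons d f g S

@[simp] theorem der_one (d : ℕ) : der d 1 = 0 := der_unit d

@[simp] theorem ev_one_zero : (1 : Corr).ev 0 = 1 := rfl

theorem smul_mul' (c : ℚ) (f g : Corr) : (c • f) * g = c • (f * g) := by
  ext S
  simp only [ev_smul, ev_mul, mul_assoc, Multiset.sum_map_mul_left]

instance : IsScalarTower ℚ Corr Corr := ⟨smul_mul'⟩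
instance : SMulCommClass ℚ Corr Corr := ⟨fun c f g => by
  change c • (f * g) = f * (c • g)
  rw [mul_comm f, mul_comm f, smul_mul']⟩

theorem mul_ev_eq_zero {g D : Corr} {S : Multiset ℕ} (h : ∀ T ≤ S, D.ev T = 0) :
    (g * D).ev S = 0 := by
  rw [ev_mul]
  refine Multiset.sum_eq_zero fun x hx => ?_
  obtain ⟨p, hp, rfl⟩ := Multiset.mem_map.1 hx
  rw [Multiset.mem_antidiagonal] at hp
  rw [h p.2 (hp ▸ Multiset.le_add_left _ _), mul_zero]

/-- A solution of a homogeneous linear first-order system vanishes if its initial value does. -/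
theorem eq_zero_of_der_eq {D : Corr} (g : ℕ → Corr) (h0 : D.ev 0 = 0)
    (h : ∀ j, der j D = g j * D) : D = 0 := by
  ext S
  induction S using Multiset.strongInductionOn with
  | _ S ih =>
    induction S using Multiset.induction with
    | empty => exact h0
    | cons j S _ =>
      rw [← ev_der, h]
      exact mul_ev_eq_zero fun T hT => ih T (lt_of_le_of_lt hT (Multiset.lt_cons_self _ _))

/-- The derivation `∑ₖ (2k+1) tₖ ∂_{k+d}`. -/
def shift (d : ℕ) : Corr →ₗ[ℚ] Corr where
  toFun f := fun S => (S.map fun k : ℕ => (2 * (k : ℚ) + 1) * f.ev ((k + d) ::ₘ S.erase k)).sum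
  map_add' f g := by
    funext S
    simp only [ev_add, mul_add, Multiset.sum_map_add]
    rfl
  map_smul' c f := by
    funext S
    simp only [ev_smul, mul_left_comm _ c, Multiset.sum_map_mul_left]
    rfl

theorem ev_shift (d : ℕ) (f : Corr) (S : Multiset ℕ) :
    (shift d f).ev S =
      (S.map fun k : ℕ => (2 * (k : ℚ) + 1) * f.ev ((k + d) ::ₘ S.erase k)).sum := rfl

@[simp] theorem ev_shift_zero (d : ℕ) (f : Corr) : (shift d f).ev 0 = 0 := by simp [ev_shift]

theorem ev_shift_cons (d k : ℕ) (f : Corr) (S : Multiset ℕ) :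
    (shift d f).ev (k ::ₘ S) =
      (2 * (k : ℚ) + 1) * f.ev ((k + d) ::ₘ S) + (shift d (der k f)).ev S := by
  rw [ev_shift, ev_shift, Multiset.map_cons, Multiset.sum_cons, Multiset.erase_cons_head]
  congr 2
  refine Multiset.map_congr rfl fun j hj => ?_
  rw [Multiset.erase_cons_tail_of_mem hj, ev_der, Multiset.cons_swap]

theorem der_shift (d k : ℕ) (f : Corr) :
    der k (shift d f) = (2 * (k : ℚ) + 1) • der (k + d) f + shift d (der k f) := by
  ext S; simp [ev_shift_cons]

theorem shift_mul (d : ℕ) (f g : Corr) : shift d (f * g) = shift d f * g + f * shift d g := by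
  ext S
  induction S using Multiset.induction generalizing f g with
  | empty => simp
  | cons k S ih =>
    rw [ev_shift_cons, der_mul, map_add, ev_add, ih, ih, ev_add, ev_add, ev_add, ev_mul_cons,
      ev_mul_cons, ev_mul_cons, der_shift, der_shift]
    simp only [add_mul, mul_add, ev_add, smul_mul_assoc, mul_smul_comm, ev_smul]
    ring

/-- The Witt algebra relation for the first-order parts of the Virasoro operators. -/
theorem shift_commutator (a b : ℕ) (f : Corr) (S : Multiset ℕ) :
    (shift a (shift b f)).ev S - (shift b (shift a f)).ev S =
      2 * ((a : ℚ) - b) * (shift (a + b) f).ev S := by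
  induction S using Multiset.induction generalizing f with
  | empty => simp
  | cons k S ih =>
    rw [ev_shift_cons, ev_shift_cons, ev_shift_cons, der_shift, der_shift, ev_shift_cons,
      ev_shift_cons]
    simp only [map_add, map_smul, ev_add, ev_smul]
    have := ih (der k f)
    rw [show k + b + a = k + a + b by ring, show k + (a + b) = k + a + b by ring]
    push_cast
    linear_combination this

end Corr
end BGW

/-! ### Linear Virasoro constraints and the disconnected correlators. -/

namespace BGW

/-- Two partial weighted sums of a symmetric function combine to its full antidiagonal sum. -/
theorem sum_weight_sub (a b : ℕ) (h : ℕ → ℕ → ℚ) (hs : ∀ x y, h x y = h y x) :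
    ∑ i ∈ Finset.range a, (2 * (i : ℚ) + 1) * h (i + b) (a - 1 - i)
      - ∑ i ∈ Finset.range b, (2 * (i : ℚ) + 1) * h (i + a) (b - 1 - i)
      = ((a : ℚ) - b) * ∑ i ∈ Finset.range (a + b), h i (a + b - 1 - i) := by
  have key : ∀ a b : ℕ, ∑ i ∈ Finset.range a, (2 * (i : ℚ) + 1) * h (i + b) (a - 1 - i)
      = ∑ c ∈ Finset.range (a + b),
          (if b ≤ c then 2 * ((c : ℚ) - b) + 1 else 0) * h c (a + b - 1 - c) := by
    intro a b
    rw [add_comm a b, Finset.sum_range_add]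
    rw [Finset.sum_eq_zero (s := Finset.range b), zero_add]
    · refine Finset.sum_congr rfl fun i hi => ?_
      rw [if_pos (by omega), add_comm i b, show b + a - 1 - (b + i) = a - 1 - i by omega]
      push_cast; ring
    · intro i hi
      rw [if_neg (by simpa using hi), zero_mul]
  rw [key a b, key b a, add_comm b a, Finset.mul_sum, ← Finset.sum_sub_distrib,
    ← sub_eq_zero, ← Finset.sum_sub_distrib]
  set F : ℕ → ℚ := fun c => (if b ≤ c then 2 * ((c : ℚ) - b) + 1 else 0) * h c (a + b - 1 - c)
    - (if a ≤ c then 2 * ((c : ℚ) - a) + 1 else 0) * h c (a + b - 1 - c)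
    - ((a : ℚ) - b) * h c (a + b - 1 - c) with hF
  -- `F` is odd under c ↦ a+b-1-c, so its sum equals its own negative.
  have hr := Finset.sum_range_reflect F (a + b)
  have hn : ∑ c ∈ Finset.range (a + b), F (a + b - 1 - c)
      = - ∑ c ∈ Finset.range (a + b), F c := by
    rw [← Finset.sum_neg_distrib]
    refine Finset.sum_congr rfl fun c hc => ?_
    have hc' : c < a + b := by simpa using hc
    simp only [hF]
    rw [show a + b - 1 - (a + b - 1 - c) = c by omega, hs (a + b - 1 - c) c]
    have hcast : ((a + b - 1 - c : ℕ) : ℚ) = a + b - 1 - c := by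
      rw [Nat.sub_sub, Nat.cast_sub (by omega)]; push_cast; ring
    rw [hcast]
    by_cases h1 : b ≤ c <;> by_cases h2 : a ≤ c
    · rw [if_pos h1, if_pos h2, if_neg (by omega), if_neg (by omega)]; ring
    · rw [if_pos h1, if_neg h2, if_pos (by omega), if_neg (by omega)]; ring
    · rw [if_neg h1, if_pos h2, if_neg (by omega), if_pos (by omega)]; ring
    · rw [if_neg h1, if_neg h2, if_pos (by omega), if_pos (by omega)]; ring
  linarith

/-- The weight `∑ (2d+1)` of a multiset. -/
def wt (S : Multiset ℕ) : ℕ := (S.map fun d => 2 * d + 1).sum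

@[simp] theorem wt_zero : wt 0 = 0 := rfl

@[simp] theorem wt_cons (d : ℕ) (S : Multiset ℕ) : wt (d ::ₘ S) = 2 * d + 1 + wt S := by
  simp [wt]

@[simp] theorem wt_add (S T : Multiset ℕ) : wt (S + T) = wt S + wt T := by simp [wt]

theorem wt_erase {d : ℕ} {S : Multiset ℕ} (h : d ∈ S) : 2 * d + 1 + wt (S.erase d) = wt S := by
  rw [← wt_cons, Multiset.cons_erase h]

namespace Corr

/-- The right-hand side of the linear Virasoro constraints. -/
noncomputable def vir (d : ℕ) (f : Corr) : Corr :=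
  shift d f + (1 / 2 : ℚ) • ∑ i ∈ Finset.range d, der i (der (d - 1 - i) f)
    + (if d = 0 then (1 / 8 : ℚ) else 0) • f

theorem ev_vir (d : ℕ) (f : Corr) (S : Multiset ℕ) :
    (vir d f).ev S = (shift d f).ev S
      + 1 / 2 * ∑ i ∈ Finset.range d, f.ev ((d - 1 - i) ::ₘ i ::ₘ S)
      + (if d = 0 then 1 / 8 else 0) * f.ev S := by
  simp only [vir, ev_add, ev_smul, ev_sum, ev_der]

/-- The constraint for `b` is substituted wherever `b` is still an entry. This is legitimate by
induction, since all those multisets have smaller weight. The result involves only `S`, so the two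
orders of removal can be compared term by term. -/
theorem vir_cons_expand {f : Corr} {a b : ℕ} {S : Multiset ℕ}
    (h : ∀ d T, wt (d ::ₘ T) < wt (a ::ₘ b ::ₘ S) → f.ev (d ::ₘ T) = (vir d f).ev T) :
    (vir a f).ev (b ::ₘ S) =
      (2 * (b : ℚ) + 1) * f.ev ((a + b) ::ₘ S)
      + ((shift a (shift b f)).ev S
        + 1 / 2 * ∑ j ∈ Finset.range b, (shift a (der j (der (b - 1 - j) f))).ev S
        + (if b = 0 then 1 / 8 else 0) * (shift a f).ev S)
      + (∑ i ∈ Finset.range a, (2 * (i : ℚ) + 1) * f.ev ((i + b) ::ₘ (a - 1 - i) ::ₘ S)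
        + 1 / 2 * ∑ i ∈ Finset.range a, (shift b (der i (der (a - 1 - i) f))).ev S
        + 1 / 4 * ∑ i ∈ Finset.range a, ∑ j ∈ Finset.range b,
            f.ev ((b - 1 - j) ::ₘ j ::ₘ (a - 1 - i) ::ₘ i ::ₘ S)
        + (if b = 0 then 1 / 8 else 0) *
            (1 / 2 * ∑ i ∈ Finset.range a, f.ev ((a - 1 - i) ::ₘ i ::ₘ S)))
      + (if a = 0 then 1 / 8 else 0) * ((shift b f).ev S
        + 1 / 2 * ∑ j ∈ Finset.range b, f.ev ((b - 1 - j) ::ₘ j ::ₘ S)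
        + (if b = 0 then 1 / 8 else 0) * f.ev S) := by
  have h1 : (shift a (der b f)).ev S = (shift a (vir b f)).ev S := by
    rw [ev_shift, ev_shift]
    congr 1
    refine Multiset.map_congr rfl fun k hk => ?_
    rw [ev_der, h]
    have := wt_erase hk
    simp only [wt_cons]; omega
  have h2 : ∀ i ∈ Finset.range a, f.ev ((a - 1 - i) ::ₘ i ::ₘ b ::ₘ S)
      = (vir b f).ev ((a - 1 - i) ::ₘ i ::ₘ S) := by
    intro i hi
    have hi' : i < a := by simpa using hi
    rw [Multiset.cons_swap i b, Multiset.cons_swap _ b, h]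
    simp only [wt_cons]; omega
  have h3 : f.ev (b ::ₘ S) = (vir b f).ev S := h _ _ (by simp only [wt_cons]; omega)
  have h4 : (shift a (vir b f)).ev S = (shift a (shift b f)).ev S
        + 1 / 2 * ∑ j ∈ Finset.range b, (shift a (der j (der (b - 1 - j) f))).ev S
        + (if b = 0 then 1 / 8 else 0) * (shift a f).ev S := by
    simp only [vir, map_add, map_smul, map_sum, ev_add, ev_smul, ev_sum]
  have h5 : ∑ i ∈ Finset.range a,
        (2 * (((a - 1 - i : ℕ)) : ℚ) + 1) * f.ev ((a - 1 - i + b) ::ₘ i ::ₘ S)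
      = ∑ i ∈ Finset.range a, (2 * (i : ℚ) + 1) * f.ev ((i + b) ::ₘ (a - 1 - i) ::ₘ S) := by
    rw [← Finset.sum_range_reflect]
    refine Finset.sum_congr rfl fun i hi => ?_
    have hi' : i < a := by simpa using hi
    rw [show a - 1 - (a - 1 - i) = i by omega]
  have h6 : ∀ i ∈ Finset.range a, (vir b f).ev ((a - 1 - i) ::ₘ i ::ₘ S)
      = (2 * (((a - 1 - i : ℕ)) : ℚ) + 1) * f.ev ((a - 1 - i + b) ::ₘ i ::ₘ S)
        + (2 * (i : ℚ) + 1) * f.ev ((i + b) ::ₘ (a - 1 - i) ::ₘ S)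
        + (shift b (der i (der (a - 1 - i) f))).ev S
        + 1 / 2 * ∑ j ∈ Finset.range b, f.ev ((b - 1 - j) ::ₘ j ::ₘ (a - 1 - i) ::ₘ i ::ₘ S)
        + (if b = 0 then 1 / 8 else 0) * f.ev ((a - 1 - i) ::ₘ i ::ₘ S) := by
    intro i hi
    rw [ev_vir, ev_shift_cons, ev_shift_cons, ev_der, Multiset.cons_swap (a - 1 - i) (i + b)]
    ring
  rw [ev_vir, ev_shift_cons, h1, h4, h3, Finset.sum_congr rfl h2, Finset.sum_congr rfl h6,
    ev_vir b f S, add_comm b a]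
  simp only [Finset.sum_add_distrib, h5, ← Finset.mul_sum]
  ring

/-- The compatibility of the constraints. The double sums are symmetric in `a` and `b`, and the
commutator terms assemble into 2(a-b) times the constraint of index a+b at `S`, whose weight is
smaller by exactly one. -/
theorem vir_swap {f : Corr} {a b : ℕ} {S : Multiset ℕ}
    (h : ∀ d T, wt (d ::ₘ T) < wt (a ::ₘ b ::ₘ S) → f.ev (d ::ₘ T) = (vir d f).ev T) :
    (vir a f).ev (b ::ₘ S) = (vir b f).ev (a ::ₘ S) := by
  rw [vir_cons_expand h, vir_cons_expand (by rwa [Multiset.cons_swap] at h)]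
  have h1 := shift_commutator a b f S
  have h2 : f.ev ((a + b) ::ₘ S) = (vir (a + b) f).ev S := h _ _ (by simp only [wt_cons]; omega)
  rw [ev_vir] at h2
  have h3 := sum_weight_sub a b (fun x y => f.ev (x ::ₘ y ::ₘ S))
    (fun x y => by rw [Multiset.cons_swap])
  have h4 : ∑ i ∈ Finset.range a, ∑ j ∈ Finset.range b,
            f.ev ((b - 1 - j) ::ₘ j ::ₘ (a - 1 - i) ::ₘ i ::ₘ S)
      = ∑ j ∈ Finset.range b, ∑ i ∈ Finset.range a,
            f.ev ((a - 1 - i) ::ₘ i ::ₘ (b - 1 - j) ::ₘ j ::ₘ S) := by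
    rw [Finset.sum_comm]
    refine Finset.sum_congr rfl fun j _ => Finset.sum_congr rfl fun i _ => ?_
    congr 1
    simp only [← Multiset.singleton_add]
    abel
  have h5 : ∑ i ∈ Finset.range (a + b), f.ev ((a + b - 1 - i) ::ₘ i ::ₘ S)
      = ∑ i ∈ Finset.range (a + b), f.ev (i ::ₘ (a + b - 1 - i) ::ₘ S) :=
    Finset.sum_congr rfl fun i _ => by rw [Multiset.cons_swap]
  rw [h5] at h2
  -- The constant 1/8 is not seen by the commutator: it occurs only at index 0, where a = b.
  have h6 : ((a : ℚ) - b) * (if a + b = 0 then 1 / 8 else 0) = 0 := by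
    split_ifs with h0
    · rw [show a = 0 by omega, show b = 0 by omega]; simp
    · simp
  rw [h4, add_comm b a]
  linear_combination h1 + h3 - 2 * ((a : ℚ) - b) * h2 - 2 * f.ev S * h6

/-- The disconnected correlators: the solution of the linear Virasoro constraints, computed by
removing the entries of a multiset in an arbitrary order. -/
noncomputable def disc (S : Multiset ℕ) : ℚ :=
  open scoped Classical in
  if h : S = 0 then 1 else
    (((S.erase (Multiset.exists_mem_of_ne_zero h).choose).attach.map
        fun k : {x // x ∈ S.erase (Multiset.exists_mem_of_ne_zero h).choose} =>
        (2 * ((k : ℕ) : ℚ) + 1) * disc ((k + (Multiset.exists_mem_of_ne_zero h).choose) ::ₘ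
          (S.erase (Multiset.exists_mem_of_ne_zero h).choose).erase k)).sum
      + 1 / 2 * ∑ i : Fin (Multiset.exists_mem_of_ne_zero h).choose,
          disc (((Multiset.exists_mem_of_ne_zero h).choose - 1 - i) ::ₘ (i : ℕ) ::ₘ
            S.erase (Multiset.exists_mem_of_ne_zero h).choose)
      + (if (Multiset.exists_mem_of_ne_zero h).choose = 0 then 1 / 8 else 0) *
          disc (S.erase (Multiset.exists_mem_of_ne_zero h).choose))
termination_by wt S
decreasing_by
  · have h1 := wt_erase (Multiset.exists_mem_of_ne_zero h).choose_spec
    have h2 := wt_erase k.2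
    simp only [wt_cons]; omega
  · have h1 := wt_erase (Multiset.exists_mem_of_ne_zero h).choose_spec
    have h2 := i.2
    simp only [wt_cons]; omega
  · have h1 := wt_erase (Multiset.exists_mem_of_ne_zero h).choose_spec
    omega

/-- `disc` as an element of the convolution algebra. -/
noncomputable def discCorr : Corr := disc

theorem ev_discCorr_zero : discCorr.ev 0 = 1 := by
  change disc 0 = 1
  rw [disc]; simp

theorem exists_ev_discCorr {S : Multiset ℕ} (h : S ≠ 0) :
    ∃ d ∈ S, discCorr.ev S = (vir d discCorr).ev (S.erase d) := by
  refine ⟨_, (Multiset.exists_mem_of_ne_zero h).choose_spec, ?_⟩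
  rw [ev_vir]
  change disc S = _
  rw [disc, dif_neg h, Finset.sum_range, ev_shift]
  rw [← Multiset.attach_map_val' (S.erase _)]
  rfl

/-- `disc` obeys the constraint only for one chosen entry; `vir_swap` transfers it to every other
entry, by induction on weight. -/
theorem ev_discCorr_cons (d : ℕ) (S : Multiset ℕ) :
    discCorr.ev (d ::ₘ S) = (vir d discCorr).ev S := by
  induction hN : wt (d ::ₘ S) using Nat.strong_induction_on generalizing d S with
  | _ N ih =>
    obtain ⟨e, he, h⟩ := exists_ev_discCorr (Multiset.cons_ne_zero (a := d) (m := S))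
    rcases Multiset.mem_cons.1 he with rfl | he'
    · rw [h, Multiset.erase_cons_head]
    · obtain ⟨T, rfl⟩ := Multiset.exists_cons_of_mem he'
      rw [h, Multiset.cons_swap, Multiset.erase_cons_head]
      refine vir_swap fun d' T' hlt => ih _ ?_ d' T' rfl
      rwa [← hN, Multiset.cons_swap]

theorem der_discCorr (d : ℕ) : der d discCorr = vir d discCorr := by
  ext S; exact ev_discCorr_cons d S

end Corr
end BGW

/-! ### Logarithm of the disconnected series: the connected correlators. -/

namespace BGW
namespace Corr

theorem mul_ev_congr {f g : Corr} (h : Corr) {S : Multiset ℕ} (hfg : ∀ T ≤ S, f.ev T = g.ev T) :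
    (h * f).ev S = (h * g).ev S := by
  rw [← sub_eq_zero, ← ev_sub, ← mul_sub]
  exact mul_ev_eq_zero fun T hT => by rw [ev_sub, hfg T hT, sub_self]

/-- Each of the `n` factors has to absorb at least one entry. -/
theorem ev_pow_eq_zero {u : Corr} (h0 : u.ev 0 = 0) {n : ℕ} {S : Multiset ℕ}
    (h : Multiset.card S < n) : (u ^ n).ev S = 0 := by
  induction n generalizing S with
  | zero => omega
  | succ n ih =>
    rw [pow_succ', ev_mul]
    refine Multiset.sum_eq_zero fun x hx => ?_
    obtain ⟨p, hp, rfl⟩ := Multiset.mem_map.1 hx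
    rw [Multiset.mem_antidiagonal] at hp
    by_cases hc : Multiset.card p.2 < n
    · rw [ih hc, mul_zero]
    · have h1 := congrArg Multiset.card hp
      rw [Multiset.card_add] at h1
      have h2 : p.1 = 0 := by rw [← Multiset.card_eq_zero]; omega
      rw [h2, h0, zero_mul]

/-- A correlator with constant term `1` is invertible. -/
theorem exists_mul_eq_one {f : Corr} (h : f.ev 0 = 1) : ∃ g, g * f = 1 := by
  have hu : (1 - f).ev 0 = 0 := by rw [ev_sub, h, ev_one_zero, sub_self]
  have stable : ∀ (N : ℕ) (T : Multiset ℕ), Multiset.card T ≤ N →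
      (∑ n ∈ Finset.range (Multiset.card T + 1), (1 - f) ^ n).ev T
        = (∑ n ∈ Finset.range (N + 1), (1 - f) ^ n).ev T := by
    intro N T hT
    rw [ev_sum, ev_sum]
    refine Finset.sum_subset (Finset.range_mono (by omega)) fun n _ hn => ev_pow_eq_zero hu ?_
    have := Finset.mem_range.not.1 hn
    omega
  -- The geometric series, truncated at an order depending on the argument; by `stable`, a single
  -- truncation represents `g` on all sub-multisets of a given `S`.
  obtain ⟨g, hgS⟩ : ∃ g : Corr, ∀ S, g.ev S
      = (∑ n ∈ Finset.range (Multiset.card S + 1), (1 - f) ^ n).ev S := ⟨_, fun _ => rfl⟩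
  refine ⟨g, ext fun S => ?_⟩
  rw [mul_comm, mul_ev_congr (g := ∑ n ∈ Finset.range (Multiset.card S + 1), (1 - f) ^ n) f
    fun T hT => (hgS T).trans (stable _ _ (Multiset.card_le_card hT)), mul_comm]
  have hg := geom_sum_mul_neg (1 - f) (Multiset.card S + 1)
  rw [sub_sub_cancel] at hg
  rw [hg, ev_sub, ev_pow_eq_zero hu (Nat.lt_succ_self _), sub_zero]

/-- The inverse of the generating series of disconnected correlators. -/
noncomputable def discInv : Corr := (exists_mul_eq_one ev_discCorr_zero).choose

theorem discInv_mul : discInv * discCorr = 1 := (exists_mul_eq_one ev_discCorr_zero).choose_spec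

/-- The logarithmic derivatives of the disconnected correlators. -/
noncomputable def logDer (d : ℕ) : Corr := der d discCorr * discInv

theorem der_discInv (d : ℕ) : der d discInv = -(discInv ^ 2 * der d discCorr) := by
  have h := congrArg (der d) discInv_mul
  rw [der_mul, der_one] at h
  have h1 := discInv_mul
  linear_combination discInv * h - der d discInv * h1

/-- Closedness of the logarithmic differential. It makes the arbitrary choice of entry in `conn`
harmless, so that `conn` is a potential. -/
theorem der_logDer_comm (a b : ℕ) : der a (logDer b) = der b (logDer a) := by
  rw [logDer, logDer, der_mul, der_mul, der_discInv, der_discInv, der_comm a b]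
  ring

/-- The connected correlators. -/
noncomputable def conn : Corr := fun S =>
  open scoped Classical in
  if h : S = 0 then 0 else
    (logDer (Multiset.exists_mem_of_ne_zero h).choose).ev
      (S.erase (Multiset.exists_mem_of_ne_zero h).choose)

theorem exists_ev_conn {S : Multiset ℕ} (h : S ≠ 0) :
    ∃ d ∈ S, conn.ev S = (logDer d).ev (S.erase d) :=
  ⟨_, (Multiset.exists_mem_of_ne_zero h).choose_spec, dif_neg h⟩

theorem der_conn (d : ℕ) : der d conn = logDer d := by
  ext S
  obtain ⟨e, he, h⟩ := exists_ev_conn (Multiset.cons_ne_zero (a := d) (m := S))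
  rw [ev_der, h]
  rcases Multiset.mem_cons.1 he with rfl | he'
  · rw [Multiset.erase_cons_head]
  · obtain ⟨T, rfl⟩ := Multiset.exists_cons_of_mem he'
    rw [Multiset.cons_swap, Multiset.erase_cons_head, ← ev_der, ← ev_der, der_logDer_comm]

theorem der_discCorr_eq (d : ℕ) : der d discCorr = der d conn * discCorr := by
  rw [der_conn, logDer, mul_assoc, discInv_mul, mul_one]

/-- The chain rule for a derivation applied to `discCorr` = exp(`conn`). The difference of the two
sides solves a homogeneous linear first-order system with zero initial value. -/
theorem shift_discCorr (d : ℕ) : shift d discCorr = shift d conn * discCorr := by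
  rw [← sub_eq_zero]
  refine eq_zero_of_der_eq (fun j => der j conn) (by simp) fun j => ?_
  rw [map_sub, der_shift, der_mul, der_shift, der_discCorr_eq j, shift_mul,
    der_discCorr_eq (j + d), add_mul, smul_mul_assoc]
  ring

/-- The Virasoro constraints for connected correlators. -/
theorem der_conn_eq (d : ℕ) :
    der d conn = shift d conn
      + (1 / 2 : ℚ) • ∑ i ∈ Finset.range d,
          (der i (der (d - 1 - i) conn) + der i conn * der (d - 1 - i) conn)
      + (if d = 0 then (1 / 8 : ℚ) else 0) • 1 := by
  have h := der_discCorr d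
  have h2 : ∀ i j, der i (der j discCorr)
      = (der i (der j conn) + der i conn * der j conn) * discCorr := by
    intro i j
    rw [der_discCorr_eq, der_mul, der_discCorr_eq]; ring
  simp only [vir, h2, ← Finset.sum_mul] at h
  rw [der_discCorr_eq, shift_discCorr, ← smul_mul_assoc,
    ← one_mul ((if d = 0 then (1 / 8 : ℚ) else 0) • discCorr), mul_smul_comm, ← smul_mul_assoc,
    ← add_mul, ← add_mul] at h
  have h3 := congrArg (· * discInv) h
  simpa only [mul_assoc, mul_comm discCorr, discInv_mul, mul_one] using h3

theorem ev_conn_cons (d : ℕ) (S : Multiset ℕ) :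
    conn.ev (d ::ₘ S) = (shift d conn).ev S
      + 1 / 2 * ∑ i ∈ Finset.range d,
          (conn.ev (i ::ₘ (d - 1 - i) ::ₘ S) + (der i conn * der (d - 1 - i) conn).ev S)
      + if d = 0 ∧ S = 0 then 1 / 8 else 0 := by
  have h := congrArg (ev · S) (der_conn_eq d)
  simp only [ev_der, ev_add, ev_smul, ev_sum] at h
  rw [h]
  congr 1
  · congr 2
    refine Finset.sum_congr rfl fun i _ => ?_
    rw [Multiset.cons_swap]
  · by_cases hd : d = 0 <;> by_cases hS : S = 0 <;> simp [hd, hS]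
    change unit S = 0
    simp [unit, hS]

/-! ### Identification of `B` with the connected correlators. -/

theorem sum_set (d : ℕ) (f : Corr) (ds : List ℕ) :
    ∑ i : Fin ds.length, (2 * (ds.get i : ℚ) + 1) * f.ev ↑(ds.set i (ds.get i + d))
      = (shift d f).ev ↑ds := by
  induction ds generalizing f with
  | nil => simp
  | cons e ds ih =>
    rw [← Multiset.cons_coe, ev_shift_cons, ← ih]
    refine (Fin.sum_univ_succ _).trans ?_
    rfl

end Corr

theorem restrict_cons_insert (d : ℕ) (ds : List ℕ) (I : Finset (Fin ds.length)) :
    restrict (d :: ds) (Finset.cons 0 (I.map (Fin.succEmb _)) (by simp)) = d :: restrict ds I := by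
  simp [restrict, List.finRange_succ, List.filter_map, Function.comp_def]

theorem restrict_cons_map (d : ℕ) (ds : List ℕ) (I : Finset (Fin ds.length)) :
    restrict (d :: ds) (I.map (Fin.succEmb _)) = restrict ds I := by
  simp [restrict, List.finRange_succ, List.filter_map, Function.comp_def]

theorem compl_map_succ {n : ℕ} (I : Finset (Fin n)) :
    (I.map (Fin.succEmb n))ᶜ = Finset.cons 0 (Iᶜ.map (Fin.succEmb n)) (by simp) := by
  ext i
  refine Fin.cases ?_ (fun j => ?_) i <;> simp

theorem compl_cons_map_succ {n : ℕ} (I : Finset (Fin n)) :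
    (Finset.cons 0 (I.map (Fin.succEmb n)) (by simp))ᶜ = Iᶜ.map (Fin.succEmb n) := by
  ext i
  refine Fin.cases ?_ (fun j => ?_) i <;> simp

theorem sum_finset_fin_succ {n : ℕ} (F : Finset (Fin (n + 1)) → ℚ) :
    ∑ I, F I = ∑ I : Finset (Fin n), F (I.map (Fin.succEmb n))
      + ∑ I : Finset (Fin n), F (Finset.cons 0 (I.map (Fin.succEmb n)) (by simp)) := by
  let e : Finset (Fin n) ⊕ Finset (Fin n) → Finset (Fin (n + 1)) :=
    Sum.elim (fun I => I.map (Fin.succEmb n))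
      (fun I => Finset.cons 0 (I.map (Fin.succEmb n)) (by simp))
  have he : Function.Bijective e := by
    rw [Fintype.bijective_iff_surjective_and_card]
    refine ⟨fun I => ?_, by simp [pow_succ, mul_two]⟩
    by_cases h : 0 ∈ I
    · refine ⟨Sum.inr (Finset.univ.filter fun i => i.succ ∈ I), ?_⟩
      ext i
      refine Fin.cases ?_ (fun j => ?_) i <;> simp [e, h]
    · refine ⟨Sum.inl (Finset.univ.filter fun i => i.succ ∈ I), ?_⟩
      ext i
      refine Fin.cases ?_ (fun j => ?_) i <;> simp [e, h]
  rw [← he.sum_comp F, Fintype.sum_sum_type]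
  rfl

/-- Splitting by index subsets and the multiset antidiagonal count repeated entries with the same
multiplicity; both sides obey the Leibniz rule when an entry is added. -/
theorem Corr.sum_restrict (f g : Corr) (ds : List ℕ) :
    ∑ I : Finset (Fin ds.length), f.ev ↑(restrict ds I) * g.ev ↑(restrict ds Iᶜ)
      = (f * g).ev ↑ds := by
  induction ds generalizing f g with
  | nil => simp [restrict]
  | cons d ds ih =>
    rw [← Multiset.cons_coe, ev_mul_cons, ← ih, ← ih]
    refine (sum_finset_fin_succ _).trans ?_
    rw [add_comm]
    congr 1
    · refine Finset.sum_congr rfl fun I _ => ?_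
      rw [compl_cons_map_succ, restrict_cons_insert, restrict_cons_map]; rfl
    · refine Finset.sum_congr rfl fun I _ => ?_
      rw [compl_map_succ, restrict_cons_insert, restrict_cons_map]; rfl

theorem B_cons (d : ℕ) (ds : List ℕ) :
    B (d :: ds) = ∑ i : Fin ds.length, (2 * (ds.get i : ℚ) + 1) * B (ds.set i (ds.get i + d))
      + 1 / 2 * ∑ a : Fin d,
          (B ((a : ℕ) :: (d - 1 - a) :: ds)
            + ∑ I : Finset (Fin ds.length),
                B ((a : ℕ) :: restrict ds I) * B ((d - 1 - a) :: restrict ds Iᶜ))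
      + if d = 0 ∧ ds = [] then 1 / 8 else 0 := by
  by_cases h : d = 0 ∧ ds = []
  · obtain ⟨rfl, rfl⟩ := h
    rw [B.eq_2]; simp
  · rw [if_neg h, add_zero, B]
    exact fun h1 h2 => h ⟨h1, h2⟩

/-- The numbers `B` are the connected correlators; in particular they are symmetric. -/
theorem B_eq_conn {ds : List ℕ} (h : ds ≠ []) : B ds = Corr.conn.ev ↑ds := by
  induction hN : X ds using Nat.strong_induction_on generalizing ds with
  | _ N ih =>
    obtain ⟨d, ds, rfl⟩ := List.exists_cons_of_ne_nil h
    have ih' : ∀ e es, X (e :: es) < X (d :: ds) → B (e :: es) = Corr.conn.ev (e ::ₘ ↑es) :=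
      fun e es hlt => ih _ (hN ▸ hlt) (List.cons_ne_nil _ _) rfl
    rw [B_cons, ← Multiset.cons_coe, Corr.ev_conn_cons, ← Corr.sum_set, Finset.sum_range]
    simp only [Multiset.coe_eq_zero]
    congr 2
    · refine Finset.sum_congr rfl fun i _ => ?_
      have h1 : ds.set i (ds.get i + d) ≠ [] := by
        intro h0
        have h2 := congrArg List.length h0
        rw [List.length_set, List.length_nil] at h2
        exact absurd i.2 (by omega)
      have h3 : X (ds.set i (ds.get i + d)) < N := by rw [X_set, ← hN, X_cons]; omega
      rw [ih _ h3 h1 rfl]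
    · congr 1
      refine Finset.sum_congr rfl fun a _ => ?_
      rw [← Corr.sum_restrict, ih' _ _ (by simp only [X_cons]; omega), Multiset.cons_coe]
      congr 1
      refine Finset.sum_congr rfl fun I _ => ?_
      have h1 := X_restrict_le ds I
      have h2 := X_restrict_le ds Iᶜ
      rw [ih' _ _ (by simp only [X_cons]; omega), ih' _ _ (by simp only [X_cons]; omega)]
      rfl

end BGW

/-! ### A two-term recursion for the one-point numbers. -/

namespace BGW

open Finset.HasAntidiagonal (antidiagonal mem_antidiagonal)

theorem sum_antidiagonal_assoc (n : ℕ) (f : ℕ → ℕ → ℕ → ℚ) :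
    ∑ p ∈ antidiagonal n, ∑ q ∈ antidiagonal p.1, f q.1 q.2 p.2
      = ∑ p ∈ antidiagonal n, ∑ q ∈ antidiagonal p.2, f p.1 q.1 q.2 := by
  rw [Finset.sum_sigma', Finset.sum_sigma']
  refine Finset.sum_nbij' (fun x => ⟨(x.2.1, x.2.2 + x.1.2), (x.2.2, x.1.2)⟩)
    (fun x => ⟨(x.1.1 + x.2.1, x.2.2), (x.1.1, x.2.1)⟩) ?_ ?_ ?_ ?_ ?_
  all_goals
    rintro ⟨⟨i, j⟩, ⟨k, l⟩⟩ h
    obtain ⟨h1, h2⟩ : i + j = n ∧ k + l = _ := by simpa using h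
    subst h2
    first
      | rfl
      | (simp only [Finset.mem_sigma, mem_antidiagonal, and_true]
         rw [← h1, add_assoc])

/-- Symmetric summation over triples `a + b + c = n`, weighted by the last entry. -/
theorem sum_antidiagonal_weighted (n : ℕ) (f : ℕ → ℕ → ℕ → ℚ) (h12 : ∀ a b c, f a b c = f b a c)
    (h23 : ∀ a b c, f a b c = f a c b) :
    3 * ∑ p ∈ antidiagonal n, ∑ q ∈ antidiagonal p.1, (p.2 : ℚ) * f q.1 q.2 p.2
      = n * ∑ p ∈ antidiagonal n, ∑ q ∈ antidiagonal p.1, f q.1 q.2 p.2 := by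
  have h1 : ∑ p ∈ antidiagonal n, ∑ q ∈ antidiagonal p.1, (q.2 : ℚ) * f q.1 q.2 p.2
      = ∑ p ∈ antidiagonal n, ∑ q ∈ antidiagonal p.1,
          (p.2 : ℚ) * f q.1 q.2 p.2 := by
    rw [sum_antidiagonal_assoc n (fun a b c => (b : ℚ) * f a b c),
      sum_antidiagonal_assoc n (fun a b c => (c : ℚ) * f a b c)]
    refine Finset.sum_congr rfl fun p _ => ?_
    rw [← Finset.Nat.sum_antidiagonal_swap]
    exact Finset.sum_congr rfl fun q _ => by rw [h23]; rfl
  have h2 : ∑ p ∈ antidiagonal n, ∑ q ∈ antidiagonal p.1, (q.1 : ℚ) * f q.1 q.2 p.2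
      = ∑ p ∈ antidiagonal n, ∑ q ∈ antidiagonal p.1,
          (q.2 : ℚ) * f q.1 q.2 p.2 := by
    refine Finset.sum_congr rfl fun p _ => ?_
    rw [← Finset.Nat.sum_antidiagonal_swap]
    exact Finset.sum_congr rfl fun q _ => by rw [h12]; rfl
  have h3 : (n : ℚ) * ∑ p ∈ antidiagonal n, ∑ q ∈ antidiagonal p.1, f q.1 q.2 p.2
      = ∑ p ∈ antidiagonal n, ∑ q ∈ antidiagonal p.1,
          ((q.1 : ℚ) * f q.1 q.2 p.2 + (q.2 : ℚ) * f q.1 q.2 p.2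
            + (p.2 : ℚ) * f q.1 q.2 p.2) := by
    rw [Finset.mul_sum]
    refine Finset.sum_congr rfl fun p hp => ?_
    rw [Finset.mul_sum]
    refine Finset.sum_congr rfl fun q hq => ?_
    rw [mem_antidiagonal] at hp hq
    rw [← hp, ← hq]; push_cast; ring
  simp only [Finset.sum_add_distrib] at h3
  rw [h3, h2, h1]; ring

namespace Corr

/-- The two-point sums over `a + b = N`. -/
theorem ev_discCorr_succ (N : ℕ) :
    discCorr.ev {N + 1} = 1 / 2 * ∑ p ∈ antidiagonal N, discCorr.ev {p.1, p.2} := by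
  have h := ev_discCorr_cons (N + 1) 0
  rw [ev_vir] at h
  rw [Finset.Nat.sum_antidiagonal_eq_sum_range_succ (fun i j => discCorr.ev {i, j})]
  simp only [ev_shift_zero, Nat.add_sub_cancel] at h
  simp only [Nat.succ_ne_zero, if_false, zero_mul, add_zero, zero_add] at h
  refine h.trans ?_
  congr 1
  refine Finset.sum_congr rfl fun i _ => ?_
  rw [Multiset.cons_swap]; rfl

theorem ev_discCorr_pair (d e : ℕ) :
    discCorr.ev {d, e} = (2 * (e : ℚ) + 1) * discCorr.ev {d + e}
      + 1 / 2 * ∑ i ∈ Finset.range d, discCorr.ev {i, d - 1 - i, e}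
      + (if d = 0 then 1 / 8 else 0) * discCorr.ev {e} := by
  have h := ev_discCorr_cons d {e}
  rw [ev_vir, ← Multiset.cons_zero, ev_shift_cons, ev_shift_zero, add_zero, add_comm e d] at h
  refine h.trans ?_
  simp only [Multiset.cons_zero]
  congr 2
  congr 1
  refine Finset.sum_congr rfl fun i _ => ?_
  rw [Multiset.cons_swap]; rfl

theorem sum_weighted_pair (N : ℕ) (w : ℕ → ℚ) :
    ∑ p ∈ antidiagonal (N + 1), w p.2 * discCorr.ev {p.1, p.2}
      = (∑ p ∈ antidiagonal (N + 1), w p.2 * (2 * (p.2 : ℚ) + 1)) * discCorr.ev {N + 1}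
        + 1 / 2 * ∑ p ∈ antidiagonal N, ∑ q ∈ antidiagonal p.1,
            w p.2 * discCorr.ev {q.1, q.2, p.2}
        + 1 / 8 * w (N + 1) * discCorr.ev {N + 1} := by
  have h1 : ∀ p ∈ antidiagonal (N + 1), w p.2 * discCorr.ev {p.1, p.2}
      = w p.2 * (2 * (p.2 : ℚ) + 1) * discCorr.ev {N + 1}
        + 1 / 2 * ∑ i ∈ Finset.range p.1, w p.2 * discCorr.ev {i, p.1 - 1 - i, p.2}
        + (if p.1 = 0 then 1 / 8 else 0) * w p.2 * discCorr.ev {p.2} := by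
    intro p hp
    rw [mem_antidiagonal] at hp
    rw [ev_discCorr_pair, hp, ← Finset.mul_sum]; ring
  rw [Finset.sum_congr rfl h1, Finset.sum_add_distrib, Finset.sum_add_distrib, ← Finset.sum_mul,
    ← Finset.mul_sum]
  congr 2
  · congr 1
    rw [Finset.Nat.sum_antidiagonal_succ]
    simp only [Finset.range_zero, Finset.sum_empty, zero_add]
    refine Finset.sum_congr rfl fun p _ => ?_
    rw [Finset.Nat.sum_antidiagonal_eq_sum_range_succ
      (fun i j => w p.2 * discCorr.ev {i, j, p.2})]
    rfl
  · rw [Finset.Nat.sum_antidiagonal_succ]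
    simp

theorem sum_antidiagonal_weights (N : ℕ) :
    ∑ p ∈ antidiagonal N, (2 * (p.2 : ℚ) + 1) = ((N : ℚ) + 1) ^ 2 := by
  induction N with
  | zero => simp
  | succ N ih => rw [Finset.Nat.sum_antidiagonal_succ, ih]; push_cast; ring

theorem sum_antidiagonal_weights_mul (N : ℕ) :
    6 * ∑ p ∈ antidiagonal N, (p.2 : ℚ) * (2 * (p.2 : ℚ) + 1)
      = (N : ℚ) * (N + 1) * (4 * N + 5) := by
  induction N with
  | zero => simp
  | succ N ih => rw [Finset.Nat.sum_antidiagonal_succ, mul_add, ih]; push_cast; ring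

/-- Two-point sums over a+b = N+1, with weights 1 and b, are expressed through one-point values and
three-point sums. By symmetry a weight on one entry equals the average weight, 1/2 or 1/3 of the
total, so weighted sums reduce to unweighted ones. Eliminating the two- and three-point sums leaves
two consecutive one-point values. -/
theorem discCorr_recursion (N : ℕ) :
    8 * ((N : ℚ) + 2) * discCorr.ev {N + 1}
      = (2 * N + 3) ^ 2 * (2 * N + 1) * discCorr.ev {N} := by
  rcases N with _ | N
  · have h := ev_discCorr_succ 0
    have h2 := ev_discCorr_pair 0 0
    simp at h h2 ⊢
    rw [h, h2]; ring
  · have hG := ev_discCorr_succ (N + 1)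
    have h0 := sum_weighted_pair N (fun _ => 1)
    have h1 := sum_weighted_pair N (fun e => e)
    have hH := sum_antidiagonal_weighted N (fun a b c => discCorr.ev {a, b, c})
      (fun a b c => congrArg discCorr.ev (Multiset.cons_swap a b {c}))
      (fun a b c => congrArg (fun S => discCorr.ev (a ::ₘ S)) (Multiset.cons_swap b c 0))
    have hsym : 2 * ∑ p ∈ antidiagonal (N + 1), (p.2 : ℚ) * discCorr.ev {p.1, p.2}
        = ((N : ℚ) + 1) * ∑ p ∈ antidiagonal (N + 1), discCorr.ev {p.1, p.2} := by
      have hs : ∑ p ∈ antidiagonal (N + 1), (p.2 : ℚ) * discCorr.ev {p.1, p.2}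
          = ∑ p ∈ antidiagonal (N + 1), (p.1 : ℚ) * discCorr.ev {p.1, p.2} := by
        rw [← Finset.Nat.sum_antidiagonal_swap]
        exact Finset.sum_congr rfl fun p _ =>
          congrArg (fun S => (p.1 : ℚ) * discCorr.ev S) (Multiset.cons_swap p.2 p.1 0)
      rw [two_mul]
      nth_rewrite 2 [hs]
      rw [← Finset.sum_add_distrib, Finset.mul_sum]
      refine Finset.sum_congr rfl fun p hp => ?_
      rw [mem_antidiagonal] at hp
      have : (p.1 : ℚ) + p.2 = N + 1 := by exact_mod_cast hp
      rw [← this]; ring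
    simp only [one_mul, sum_antidiagonal_weights] at h0 h1
    have hw := sum_antidiagonal_weights_mul (N + 1)
    push_cast at hG h0 h1 hH hsym hw ⊢
    linear_combination 8 * ((N : ℚ) + 3) * hG + 24 * h1 - 12 * hsym + 4 * hH - 8 * N * h0
      + 4 * discCorr.ev {N + 1} * hw

end Corr
end BGW

/-! ### Closed one-point formula and continuation to negative d. -/

namespace BGW

/-- The function `(2d+1)!!³ / 4^(d+1)`, extended to all integers. -/
def growth : ℤ → ℚ
  | Int.ofNat n => ((2 * n + 1)‼ : ℚ) ^ 3 / 4 ^ (n + 1)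
  | Int.negSucc k => ∏ i ∈ Finset.range k, 4 / (-(2 * (i : ℚ) + 1)) ^ 3

theorem growth_natCast (n : ℕ) : growth n = ((2 * n + 1)‼ : ℚ) ^ 3 / 4 ^ (n + 1) := rfl

theorem growth_add_one (d : ℤ) : growth (d + 1) = growth d * ((2 * d + 3) ^ 3 / 4) := by
  rcases d with n | _ | k
  · change ((2 * (n + 1) + 1)‼ : ℚ) ^ 3 / 4 ^ (n + 1 + 1)
      = ((2 * n + 1)‼ : ℚ) ^ 3 / 4 ^ (n + 1) * ((2 * ((n : ℤ) : ℚ) + 3) ^ 3 / 4)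
    rw [show 2 * (n + 1) + 1 = (2 * n + 1) + 2 by ring, Nat.doubleFactorial_add_two]
    push_cast
    field_simp
    ring
  · change ((1)‼ : ℚ) ^ 3 / 4 ^ 1 = 1 * ((2 * (((-1 : ℤ)) : ℚ) + 3) ^ 3 / 4)
    norm_num [Nat.doubleFactorial]
  · change ∏ i ∈ Finset.range k, 4 / (-(2 * (i : ℚ) + 1)) ^ 3
      = (∏ i ∈ Finset.range (k + 1), 4 / (-(2 * (i : ℚ) + 1)) ^ 3)
        * ((2 * ((Int.negSucc (k + 1) : ℤ) : ℚ) + 3) ^ 3 / 4)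
    rw [Finset.prod_range_succ, Int.cast_negSucc, mul_assoc]
    have h : (2 * (k : ℚ) + 1) ≠ 0 := by positivity
    have h2 : 2 * -(((k + 1 + 1 : ℕ)) : ℚ) + 3 = -(2 * k + 1) := by push_cast; ring
    rw [h2, div_mul_div_comm, mul_comm (4 : ℚ), div_self, mul_one]
    exact mul_ne_zero (pow_ne_zero _ (neg_ne_zero.2 h)) (by norm_num)

theorem growth_ne_zero (d : ℤ) : growth d ≠ 0 := by
  rcases d with n | k
  · exact div_ne_zero (pow_ne_zero _ (Nat.cast_ne_zero.2 (Nat.doubleFactorial_pos _).ne'))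
      (by positivity)
  · refine Finset.prod_ne_zero_iff.2 fun i _ => div_ne_zero (by norm_num) (pow_ne_zero _ ?_)
    exact neg_ne_zero.2 (by positivity)

/-- The function `1 / (2^d d!)`, extended by zero to the negative integers. -/
def recip : ℤ → ℚ
  | Int.ofNat n => 1 / (2 ^ n * (n ! : ℚ))
  | Int.negSucc _ => 0

theorem recip_natCast (n : ℕ) : recip n = 1 / (2 ^ n * (n ! : ℚ)) := rfl

/-- At d = -1 the factor 2d+2 vanishes, which is why extension by zero is consistent. -/
theorem recip_eq (d : ℤ) : recip d = (2 * d + 2) * recip (d + 1) := by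
  rcases d with n | _ | k
  · change 1 / (2 ^ n * (n ! : ℚ))
      = (2 * ((n : ℤ) : ℚ) + 2) * (1 / (2 ^ (n + 1) * ((n + 1)! : ℚ)))
    rw [Nat.factorial_succ]
    push_cast
    have : (n ! : ℚ) ≠ 0 := Nat.cast_ne_zero.2 (Nat.factorial_ne_zero n)
    have h2 : (n : ℚ) + 1 ≠ 0 := by positivity
    field_simp
    ring
  · change (0 : ℚ) = (2 * (((-1 : ℤ)) : ℚ) + 2) * _
    norm_num
  · change (0 : ℚ) = _ * 0
    simp

theorem recip_ne_zero {d : ℤ} (h : 0 ≤ d) : recip d ≠ 0 := by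
  lift d to ℕ using h
  rw [recip_natCast]
  have := Nat.factorial_ne_zero d
  positivity

namespace Corr

theorem ev_conn_singleton (N : ℕ) : conn.ev {N} = discCorr.ev {N} := by
  have h := congrArg (ev · 0) (der_discCorr_eq N)
  simp only [ev_mul_zero, ev_discCorr_zero, mul_one, ev_der, Multiset.cons_zero] at h
  exact h.symm

/-- The one-point numbers. -/
theorem one_point (n : ℕ) :
    (2 * (n : ℚ) + 1) * conn.ev {n} = growth n * recip (n + 1) := by
  induction n with
  | zero =>
    have h := ev_conn_cons 0 0
    simp only [ev_shift_zero] at h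
    simp at h
    rw [h]
    change _ = ((1)‼ : ℚ) ^ 3 / 4 ^ 1 * (1 / (2 ^ 1 * (1 ! : ℚ)))
    norm_num [Nat.doubleFactorial, Nat.factorial]
  | succ n ih =>
    have h := discCorr_recursion n
    rw [← ev_conn_singleton, ← ev_conn_singleton] at h
    have h1 := growth_add_one n
    have h2 := recip_eq (n + 1)
    push_cast at h1 h2 ⊢
    rw [h2] at ih
    rw [h1]
    have h3 : (n : ℚ) + 2 ≠ 0 := by positivity
    refine mul_left_cancel₀ h3 ?_
    linear_combination (2 * (n : ℚ) + 3) / 8 * h + (2 * (n : ℚ) + 3) ^ 3 / 8 * ih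

/-- The connected correlator with one distinguished entry `d`, extended to negative `d` by the
unstable terms: `-1` at `d = -1` and no other entries, and `2k+1` at `d = -1-k` with one other
entry `k`. -/
noncomputable def extd : ℤ → Corr
  | Int.ofNat n => der n conn
  | Int.negSucc k => fun S =>
      if S = 0 ∧ k = 0 then -1 else if S = {k} then 2 * (k : ℚ) + 1 else 0

theorem extd_natCast (n : ℕ) : extd n = der n conn := rfl

theorem ev_extd_negSucc_zero (k : ℕ) :
    (extd (Int.negSucc k)).ev 0 = if k = 0 then -1 else 0 := by
  change (if (0 : Multiset ℕ) = 0 ∧ k = 0 then -1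
    else if (0 : Multiset ℕ) = {k} then 2 * (k : ℚ) + 1 else 0) = _
  rw [if_neg (c := (0 : Multiset ℕ) = {k}) (Multiset.singleton_ne_zero k).symm]
  simp

theorem ev_one (S : Multiset ℕ) : (1 : Corr).ev S = if S = 0 then 1 else 0 := rfl

theorem der_extd_negSucc (j k : ℕ) :
    der j (extd (Int.negSucc k)) = (if j = k then 2 * (k : ℚ) + 1 else 0) • (1 : Corr) := by
  ext S
  rw [ev_smul, ev_one]
  change (if j ::ₘ S = 0 ∧ k = 0 then -1 else if j ::ₘ S = {k} then 2 * (k : ℚ) + 1 else 0) = _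
  rw [if_neg (by simp)]
  by_cases hS : S = 0
  · simp [hS]
  · rw [if_neg, if_neg hS, mul_zero]
    intro h
    have := congrArg Multiset.card h
    simp at this
    exact hS this

@[simp] theorem shift_one (d : ℕ) : shift d 1 = 0 := by
  ext S
  induction S using Multiset.induction with
  | empty => simp
  | cons k S ih => rw [ev_shift_cons, ← ev_der]; simp

/-- This fixes the unstable value -1: at d = -1 the right side is 1 and 2d+1 = -1. -/
theorem extd_zero (d : ℤ) : (2 * (d : ℚ) + 1) * (extd d).ev 0 = growth d * recip (d + 1) := by
  rcases d with n | _ | k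
  · exact one_point n
  · change (2 * (((-1 : ℤ)) : ℚ) + 1) * (extd (Int.negSucc 0)).ev 0
      = 1 * (1 / (2 ^ 0 * (0 ! : ℚ)))
    rw [ev_extd_negSucc_zero]
    norm_num
  · rw [ev_extd_negSucc_zero]
    change _ = _ * (0 : ℚ)
    simp

/-- The recursion removing an entry `l`, with the distinguished entry `d` an arbitrary integer. -/
theorem extd_cons (d : ℤ) (l : ℕ) (S : Multiset ℕ) :
    (extd d).ev (l ::ₘ S) = (shift l (extd d)).ev S + (2 * (d : ℚ) + 1) * (extd (d + l)).ev S
      + 1 / 2 * ∑ i ∈ Finset.range l, (extd d).ev (i ::ₘ (l - 1 - i) ::ₘ S)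
      + ∑ i ∈ Finset.range l, (der i conn * der (l - 1 - i) (extd d)).ev S := by
  rcases d with n | k
  · change (extd n).ev _ = (shift l (extd n)).ev S
      + (2 * (((n : ℤ)) : ℚ) + 1) * (extd ((n + l : ℕ))).ev S
      + 1 / 2 * ∑ i ∈ Finset.range l, (extd n).ev (i ::ₘ (l - 1 - i) ::ₘ S)
      + ∑ i ∈ Finset.range l, (der i conn * der (l - 1 - i) (extd n)).ev S
    rw [extd_natCast, extd_natCast, ev_der, Multiset.cons_swap, ev_conn_cons, ev_shift_cons,
      if_neg (by simp), add_zero, ev_der, Int.cast_natCast]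
    -- The spectator `n` may fall into either factor of the product. The two sums agree by
    -- reflection, which removes the 1/2 from the quadratic term.
    have h1 : ∀ i ∈ Finset.range l,
        conn.ev (i ::ₘ (l - 1 - i) ::ₘ n ::ₘ S)
          + (der i conn * der (l - 1 - i) conn).ev (n ::ₘ S)
        = (der n conn).ev (i ::ₘ (l - 1 - i) ::ₘ S)
          + (der i conn * der (l - 1 - i) (der n conn)).ev S
          + (der (l - 1 - i) conn * der i (der n conn)).ev S := by
      intro i _
      rw [ev_mul_cons, ev_der, Multiset.cons_swap (l - 1 - i), Multiset.cons_swap i,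
        mul_comm (der n (der i conn)), der_comm n, der_comm n]
      ring
    have h2 : ∑ i ∈ Finset.range l, (der (l - 1 - i) conn * der i (der n conn)).ev S
        = ∑ i ∈ Finset.range l, (der i conn * der (l - 1 - i) (der n conn)).ev S := by
      rw [← Finset.sum_range_reflect]
      refine Finset.sum_congr rfl fun i hi => ?_
      have : i < l := by simpa using hi
      rw [show l - 1 - (l - 1 - i) = i by omega]
    rw [Finset.sum_congr rfl h1, Finset.sum_add_distrib, Finset.sum_add_distrib, h2]
    ring
  -- At negative d only multisets with at most one entry carry a nonzero value.
  · have h1 : ∑ i ∈ Finset.range l, (extd (Int.negSucc k)).ev (i ::ₘ (l - 1 - i) ::ₘ S) = 0 :=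
      Finset.sum_eq_zero fun i _ => by
        rw [← ev_der, ← ev_der, der_comm, der_extd_negSucc, map_smul, der_one, smul_zero, ev_zero]
    have h2 : ∑ i ∈ Finset.range l, (der i conn * der (l - 1 - i) (extd (Int.negSucc k))).ev S
        = if k < l then (2 * (k : ℚ) + 1) * conn.ev ((l - 1 - k) ::ₘ S) else 0 := by
      simp only [der_extd_negSucc, mul_smul_comm, mul_one, ev_smul, ev_der]
      split_ifs with hk
      · rw [Finset.sum_eq_single (l - 1 - k)]
        · rw [if_pos (by omega)]
        · intro i hi hne
          have : i < l := by simpa using hi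
          rw [if_neg (by omega), zero_mul]
        · intro hn
          exact absurd (Finset.mem_range.2 (by omega)) hn
      · refine Finset.sum_eq_zero fun i hi => ?_
        have : i < l := by simpa using hi
        rw [if_neg (by omega), zero_mul]
    have h3 : ∀ m T, (shift l (extd (Int.negSucc k))).ev (m ::ₘ T)
        = (2 * (m : ℚ) + 1) * (if m + l = k then 2 * (k : ℚ) + 1 else 0)
          * (if T = 0 then 1 else 0) := by
      intro m T
      rw [ev_shift_cons, der_extd_negSucc, ← ev_der, der_extd_negSucc, map_smul, shift_one,
        smul_zero, ev_zero, add_zero, ev_smul, ev_one]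
      ring
    have hc : (2 * (((Int.negSucc k : ℤ)) : ℚ) + 1) = -(2 * (k : ℚ) + 1) := by
      rw [Int.cast_negSucc]; push_cast; ring
    rw [h1, h2, hc, ← ev_der, der_extd_negSucc, ev_smul, ev_one]
    by_cases hk : k < l
    -- Here d+l is stable again, and its term cancels the one surviving product, in which the
    -- unstable two-point value 2k+1 occurs.
    · rw [if_pos hk, if_neg (by omega), show Int.negSucc k + l = ((l - 1 - k : ℕ) : ℤ) by omega,
        extd_natCast, ev_der]
      have h4 : (shift l (extd (Int.negSucc k))).ev S = 0 := by
        rcases Multiset.empty_or_exists_mem S with rfl | ⟨m, hm⟩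
        · simp
        · obtain ⟨T, rfl⟩ := Multiset.exists_cons_of_mem hm
          rw [h3, if_neg (by omega)]; ring
      rw [h4]; ring
    · rw [if_neg hk, show Int.negSucc k + l = Int.negSucc (k - l) by omega]
      rcases Multiset.empty_or_exists_mem S with rfl | ⟨m, hm⟩
      · rw [ev_shift_zero, ev_extd_negSucc_zero]
        by_cases hl : l = k
        · subst hl; simp
        · rw [if_neg hl, if_neg (show ¬k - l = 0 by omega)]; simp
      · obtain ⟨T, rfl⟩ := Multiset.exists_cons_of_mem hm
        rw [h3, ← ev_der, der_extd_negSucc, ev_smul, ev_one]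
        -- If m+l = k and `T` is empty, the shift term (2m+1)(2k+1) cancels the (2d+1) term, since
        -- 2d+1 = -(2k+1).
        by_cases hm : m + l = k
        · subst hm
          rw [if_pos rfl, Nat.add_sub_cancel, if_pos rfl, if_neg Multiset.cons_ne_zero]
          ring
        · rw [if_neg hm, if_neg (show ¬m = k - l by omega)]
          simp

end Corr
end BGW

/-! ### Polynomial structure in the distinguished entry. -/

namespace BGW

open Polynomial

theorem half_mem_ZHalf : (1 / 2 : ℚ) ∈ ZHalf := Algebra.subset_adjoin rfl

/-- The element `1/2` of `ℤ[1/2]`. -/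
def half : ZHalf := ⟨1 / 2, half_mem_ZHalf⟩

@[simp] theorem coe_half : (half : ℚ) = 1 / 2 := rfl

theorem natCast_mem_ZHalf (n : ℕ) : (n : ℚ) ∈ ZHalf := natCast_mem ZHalf n

/-- Needed because correlators not involving d appear as coefficients in the quadratic terms. -/
theorem Corr.ev_conn_mem (S : Multiset ℕ) : Corr.conn.ev S ∈ ZHalf := by
  induction hN : wt S using Nat.strong_induction_on generalizing S with
  | _ N ih =>
    subst hN
    rcases Multiset.empty_or_exists_mem S with rfl | ⟨d, hd⟩
    · have : Corr.conn.ev 0 = 0 := by unfold Corr.conn Corr.ev; exact dif_pos rfl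
      rw [this]; exact zero_mem _
    · obtain ⟨T, rfl⟩ := Multiset.exists_cons_of_mem hd
      have ih' : ∀ U, wt U < 2 * d + 1 + wt T → Corr.conn.ev U ∈ ZHalf :=
        fun U hU => ih _ (by rwa [wt_cons]) U rfl
      rw [Corr.ev_conn_cons, Corr.ev_shift]
      refine add_mem (add_mem (multiset_sum_mem _ fun x hx => ?_)
        (mul_mem half_mem_ZHalf (sum_mem fun i hi => add_mem (ih' _ ?_) ?_))) ?_
      · obtain ⟨k, hk, rfl⟩ := Multiset.mem_map.1 hx
        have := wt_erase hk
        refine mul_mem (by exact_mod_cast natCast_mem_ZHalf (2 * k + 1)) (ih' _ ?_)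
        simp only [wt_cons]; omega
      · have : i < d := by simpa using hi
        simp only [wt_cons]; omega
      · rw [Corr.ev_mul]
        refine multiset_sum_mem _ fun x hx => ?_
        obtain ⟨p, hp, rfl⟩ := Multiset.mem_map.1 hx
        rw [Multiset.mem_antidiagonal] at hp
        have : i < d := by simpa using hi
        have h2 := congrArg wt hp
        rw [wt_add] at h2
        exact mul_mem (ih' _ (by simp only [wt_cons]; omega))
          (ih' _ (by simp only [wt_cons]; omega))
      · split_ifs
        · rw [show (1 / 8 : ℚ) = (1 / 2) ^ 3 by norm_num]
          exact pow_mem half_mem_ZHalf 3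
        · exact zero_mem _

section PolynomialLemmas

variable {R : Type*} [CommRing R]

theorem natDegree_mul_X_add_C_le {q : R[X]} {N : ℕ} (h : q.natDegree ≤ N) (b : R) :
    (q * (Polynomial.X + Polynomial.C b)).natDegree ≤ N + 1 := by
  refine natDegree_mul_le.trans (add_le_add h ?_)
  exact (natDegree_add_le _ _).trans (by simp [natDegree_X_le])

theorem coeff_mul_X_add_C {q : R[X]} {N : ℕ} (h : q.natDegree ≤ N) (b : R) :
    (q * (Polynomial.X + Polynomial.C b)).coeff (N + 1) = q.coeff N := by
  rw [mul_add, coeff_add, coeff_mul_X, coeff_mul_C,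
    coeff_eq_zero_of_natDegree_lt (Nat.lt_succ_of_le h), zero_mul, add_zero]

theorem coeff_taylor_of_natDegree_le {q : R[X]} {N : ℕ} (h : q.natDegree ≤ N) (b : R) :
    (taylor b q).coeff N = q.coeff N := by
  rcases h.lt_or_eq with h | rfl
  · rw [coeff_eq_zero_of_natDegree_lt h,
      coeff_eq_zero_of_natDegree_lt (by rwa [natDegree_taylor])]
  · rw [coeff_taylor_natDegree]; rfl

theorem aeval_taylor {A : Type*} [CommRing A] [Algebra R A] (b : R) (q : R[X]) (x : A) :
    aeval x (taylor b q) = aeval (x + algebraMap R A b) q := by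
  rw [taylor_apply, aeval_comp]; simp

theorem exists_eq_mul_X_add_C {q : R[X]} {N : ℕ} (h : q.natDegree ≤ N + 1) {b : R}
    (hb : q.eval (-b) = 0) :
    ∃ q' : R[X], q = q' * (Polynomial.X + Polynomial.C b) ∧ q'.natDegree ≤ N ∧
      q'.coeff N = q.coeff (N + 1) := by
  obtain ⟨q', hq'⟩ := dvd_iff_isRoot.2 (show q.IsRoot (-b) from hb)
  have h1 : q = q' * (Polynomial.X + Polynomial.C b) := by rw [hq', C_neg]; ring
  have h2 : q'.natDegree ≤ N := by
    nontriviality R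
    by_cases h0 : q' = 0
    · simp [h0]
    · have := (monic_X_add_C b).natDegree_mul' h0
      rw [mul_comm, ← h1, natDegree_X_add_C] at this
      omega
  exact ⟨q', h1, h2, by rw [h1, coeff_mul_X_add_C h2]⟩

end PolynomialLemmas

/-- `f(d)` is `(2d+1)!!³ / (4^(d+1) (2d+2K)!!)` times a polynomial in `2d` over `ℤ[1/2]`
whose degree is at most `w - 2 + K`, with `c` as the coefficient in that degree. -/
def IsAsymp (w : ℕ) (c : ZHalf) (f : ℤ → ℚ) : Prop :=
  ∃ (K N : ℕ) (q : ZHalf[X]), N + 2 = w + K ∧ q.natDegree ≤ N ∧ q.coeff N = c ∧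
    ∀ d : ℤ, f d = growth d * aeval (2 * (d : ℚ)) q * recip (d + K)

namespace IsAsymp

variable {w : ℕ} {c : ZHalf} {f : ℤ → ℚ}

theorem congr {w' : ℕ} {c' : ZHalf} {f' : ℤ → ℚ} (h : IsAsymp w c f) (hw : w = w') (hc : c = c')
    (hf : ∀ d, f d = f' d) : IsAsymp w' c' f' := by
  obtain rfl : f = f' := funext hf
  subst hw hc
  exact h

/-- Multiplying the polynomial by 2d+2K+2 raises K by one and keeps w and the top coefficient, so
any two functions can be brought to a common K. -/
theorem exists_of_le (h : IsAsymp w c f) : ∃ K₀, ∀ K, K₀ ≤ K → ∃ (N : ℕ) (q : ZHalf[X]),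
    N + 2 = w + K ∧ q.natDegree ≤ N ∧ q.coeff N = c ∧
      ∀ d : ℤ, f d = growth d * aeval (2 * (d : ℚ)) q * recip (d + K) := by
  obtain ⟨K₀, N, q, hN, hdeg, hc, hf⟩ := h
  refine ⟨K₀, fun K hK => ?_⟩
  induction K, hK using Nat.le_induction with
  | base => exact ⟨N, q, hN, hdeg, hc, hf⟩
  | succ K _ ih =>
    obtain ⟨N, q, hN, hdeg, hc, hf⟩ := ih
    refine ⟨N + 1, q * (Polynomial.X + Polynomial.C (((2 * K + 2 : ℕ)) : ZHalf)), by omega,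
      natDegree_mul_X_add_C_le hdeg _, by rw [coeff_mul_X_add_C hdeg, hc], fun d => ?_⟩
    rw [hf, recip_eq]
    simp only [map_mul, map_add, aeval_X, map_natCast]
    push_cast
    rw [add_assoc d]
    ring

theorem add {c' : ZHalf} {f' : ℤ → ℚ} (h : IsAsymp w c f) (h' : IsAsymp w c' f') :
    IsAsymp w (c + c') (fun d => f d + f' d) := by
  obtain ⟨K₁, h₁⟩ := h.exists_of_le
  obtain ⟨K₂, h₂⟩ := h'.exists_of_le
  obtain ⟨N, q, hN, hdeg, hc, hf⟩ := h₁ (max K₁ K₂) (le_max_left _ _)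
  obtain ⟨N', q', hN', hdeg', hc', hf'⟩ := h₂ (max K₁ K₂) (le_max_right _ _)
  obtain rfl : N = N' := by omega
  exact ⟨_, N, q + q', hN, (natDegree_add_le _ _).trans (max_le hdeg hdeg'),
    by rw [coeff_add, hc, hc'], fun d => by simp only [hf, hf', map_add]; ring⟩

theorem const_mul (h : IsAsymp w c f) (a : ZHalf) : IsAsymp w (a * c) (fun d => (a : ℚ) * f d) := by
  obtain ⟨K, N, q, hN, hdeg, hc, hf⟩ := h
  refine ⟨K, N, Polynomial.C a * q, hN, (natDegree_C_mul_le _ _).trans hdeg,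
    by rw [coeff_C_mul, hc],
    fun d => ?_⟩
  simp only [hf, map_mul, aeval_C]
  change _ = growth d * ((a : ℚ) * _) * _
  ring

theorem weaken {w' : ℕ} (h : IsAsymp w c f) (hw : w < w') : IsAsymp w' 0 f := by
  obtain ⟨K, N, q, hN, hdeg, hc, hf⟩ := h
  exact ⟨K, N + (w' - w), q, by omega, by omega,
    coeff_eq_zero_of_natDegree_lt (by omega), hf⟩

theorem zero (w : ℕ) : IsAsymp w 0 (fun _ => 0) :=
  ⟨2, w, 0, rfl, by simp, by simp, fun d => by simp⟩

theorem multiset_sum {ι : Type*} (s : Multiset ι) {F : ι → ℤ → ℚ}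
    (h : ∀ i ∈ s, IsAsymp w 0 (F i)) : IsAsymp w 0 (fun d => (s.map fun i => F i d).sum) := by
  induction s using Multiset.induction with
  | empty => simpa using zero w
  | cons i s ih =>
    have := (h i (Multiset.mem_cons_self _ _)).add
      (ih fun j hj => h j (Multiset.mem_cons_of_mem hj))
    simpa using this

theorem finset_sum {ι : Type*} (s : Finset ι) {F : ι → ℤ → ℚ}
    (h : ∀ i ∈ s, IsAsymp w 0 (F i)) : IsAsymp w 0 (fun d => ∑ i ∈ s, F i d) :=
  multiset_sum s.val h

theorem linear_mul (h : IsAsymp w c f) (b : ℕ) :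
    IsAsymp (w + 1) c (fun d => (2 * (d : ℚ) + b) * f d) := by
  obtain ⟨K, N, q, hN, hdeg, hc, hf⟩ := h
  refine ⟨K, N + 1, q * (Polynomial.X + Polynomial.C (b : ZHalf)), by omega,
    natDegree_mul_X_add_C_le hdeg _,
    by rw [coeff_mul_X_add_C hdeg, hc], fun d => ?_⟩
  simp only [hf, map_mul, map_add, aeval_X, map_natCast]
  ring

/-- The growth factor contributes (2d+3)³/4: degree 3, of which one is absorbed by the increase of
K, and a factor 1/4 in the top coefficient. -/
theorem comp_add_one (h : IsAsymp w c f) :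
    IsAsymp (w + 2) (c * half ^ 2) (fun d => f (d + 1)) := by
  obtain ⟨K, N, q, hN, hdeg, hc, hf⟩ := h
  have hdeg0 : (taylor (2 : ZHalf) q).natDegree ≤ N := by rwa [natDegree_taylor]
  have hdeg1 := natDegree_mul_X_add_C_le hdeg0 3
  have hdeg2 := natDegree_mul_X_add_C_le hdeg1 3
  have hdeg3 := natDegree_mul_X_add_C_le hdeg2 3
  refine ⟨K + 1, N + 3, taylor (2 : ZHalf) q * (Polynomial.X + Polynomial.C 3)
    * (Polynomial.X + Polynomial.C 3) * (Polynomial.X + Polynomial.C 3)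
    * Polynomial.C (half ^ 2), by omega,
    (natDegree_mul_C_le _ _).trans hdeg3, ?_, fun d => ?_⟩
  · rw [coeff_mul_C, coeff_mul_X_add_C hdeg2, coeff_mul_X_add_C hdeg1, coeff_mul_X_add_C hdeg0,
      coeff_taylor_of_natDegree_le hdeg, hc]
  · have h2 : algebraMap ZHalf ℚ (half ^ 2) = 1 / 4 := by
      change ((half ^ 2 : ZHalf) : ℚ) = 1 / 4
      rw [SubmonoidClass.coe_pow, coe_half]; norm_num
    have h3 : algebraMap ZHalf ℚ 3 = 3 := map_ofNat _ 3
    have h4 : algebraMap ZHalf ℚ 2 = 2 := map_ofNat _ 2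
    simp only [hf, growth_add_one, map_mul, map_add, aeval_X, aeval_C, aeval_taylor, h2, h3, h4]
    push_cast
    rw [show d + 1 + (K : ℤ) = d + (K + 1) by ring, show 2 * ((d : ℚ) + 1) = 2 * d + 2 by ring]
    ring

theorem comp_add (h : IsAsymp w c f) (l : ℕ) :
    IsAsymp (w + 2 * l) (c * half ^ (2 * l)) (fun d => f (d + l)) := by
  induction l with
  | zero => simpa using h
  | succ l ih =>
    have := ih.comp_add_one
    rw [mul_assoc, ← pow_add] at this
    refine this.congr (by ring) (by ring_nf) fun d => ?_
    rw [Nat.cast_succ, ← add_assoc, add_right_comm]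

/-- A function in the class that vanishes at all negative integers has no denominator. -/
theorem exists_polynomial (h : IsAsymp w c f) (hw : 2 ≤ w) (hf0 : ∀ k : ℕ, f (Int.negSucc k) = 0) :
    ∃ q : ZHalf[X], q.natDegree ≤ w - 2 ∧ q.coeff (w - 2) = c ∧
      ∀ d : ℤ, f d = growth d * aeval (2 * (d : ℚ)) q * recip d := by
  obtain ⟨K, N, q, hN, hdeg, hc, hf⟩ := h
  induction K generalizing N q with
  | zero =>
    obtain rfl : N = w - 2 := by omega
    exact ⟨q, hdeg, hc, by simpa using hf⟩
  | succ K ih =>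
    obtain ⟨N, rfl⟩ : ∃ M, N = M + 1 := ⟨N - 1, by omega⟩
    have h1 := hf (Int.negSucc K)
    rw [hf0, show Int.negSucc K + ((K + 1 : ℕ) : ℤ) = 0 by omega] at h1
    -- At d = -(K+1) neither `growth` nor `recip 0` vanishes, so the zero of `f` must be a root of
    -- `q`.
    have h2 : aeval (2 * ((Int.negSucc K : ℤ) : ℚ)) q = 0 := by
      have h3 := growth_ne_zero (Int.negSucc K)
      have h4 := recip_ne_zero le_rfl
      simpa [h3, h4] using h1.symm
    have h3 : q.eval (-((2 * K + 2 : ℕ) : ZHalf)) = 0 := by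
      have h4 : 2 * ((Int.negSucc K : ℤ) : ℚ)
          = algebraMap ZHalf ℚ (-((2 * K + 2 : ℕ) : ZHalf)) := by
        rw [map_neg, map_natCast, Int.cast_negSucc]; push_cast; ring
      rw [h4, aeval_algebraMap_apply] at h2
      exact Subtype.ext h2
    obtain ⟨q', hq, hdeg', hc'⟩ := exists_eq_mul_X_add_C hdeg h3
    refine ih N q' (by omega) hdeg' (hc'.trans hc) fun d => ?_
    rw [hf, hq, recip_eq (d + K)]
    simp only [map_mul, map_add, aeval_X, map_natCast]
    push_cast
    rw [add_assoc d]
    ring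

end IsAsymp

open Corr

/-- The one-point formula has 2d+1 in its denominator. For l = 0 the prefactor cancels it; for l > 0
the shifted factor 2d+3 divides the cube in the growth step, leaving (2d+3)²/4. -/
theorem isAsymp_extd_zero (l : ℕ) :
    IsAsymp (2 * l + 1) (half ^ (2 * l)) (fun d => (2 * (d : ℚ) + 1) * (extd (d + l)).ev 0) := by
  rcases l with _ | l
  · refine ⟨1, 0, 1, by omega, by simp, by simp, fun d => ?_⟩
    have := extd_zero d
    simpa using this
  · have h : IsAsymp 2 (half ^ 2) (fun d => (extd (d + 1)).ev 0) := by
      refine ⟨2, 2, (Polynomial.X + Polynomial.C 3) * (Polynomial.X + Polynomial.C 3)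
        * Polynomial.C (half ^ 2), rfl, ?_, ?_, fun d => ?_⟩
      · refine (natDegree_mul_C_le _ _).trans ?_
        exact natDegree_mul_X_add_C_le (natDegree_X_add_C 3).le 3
      · rw [coeff_mul_C, coeff_mul_X_add_C (natDegree_X_add_C 3).le]
        simp
      · have h1 := extd_zero (d + 1)
        rw [growth_add_one, show d + 1 + 1 = d + ((2 : ℕ) : ℤ) by push_cast; ring] at h1
        have h2 : 2 * (d : ℚ) + 3 ≠ 0 := by
          have : 2 * d + 3 ≠ 0 := by omega
          exact_mod_cast this
        have h3 : algebraMap ZHalf ℚ (half ^ 2) = 1 / 4 := by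
          change ((half ^ 2 : ZHalf) : ℚ) = 1 / 4
          rw [SubmonoidClass.coe_pow, coe_half]; norm_num
        have h4 : algebraMap ZHalf ℚ 3 = 3 := map_ofNat _ 3
        refine mul_left_cancel₀ h2 ?_
        simp only [map_mul, map_add, aeval_X, aeval_C, h3, h4]
        push_cast at h1 ⊢
        linear_combination h1
    have h1 := (h.comp_add l).linear_mul 1
    rw [← pow_add] at h1
    refine h1.congr (by ring) (by ring_nf) fun d => ?_
    push_cast
    rw [add_assoc d]

/-- In `extd_cons` only the term (2d+1)·`extd (d + l)` reaches weight `wt S`: the shift by l gives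
2l and the prefactor gives 1. All other terms have smaller weight and do not affect the top
coefficient. -/
theorem isAsymp_extd {S : Multiset ℕ} (hS : S ≠ 0) :
    IsAsymp (wt S) (half ^ (2 * S.sum)) (fun d => (extd d).ev S) := by
  induction hN : wt S using Nat.strong_induction_on generalizing S with
  | _ N ih =>
    subst hN
    obtain ⟨l, hl⟩ := Multiset.exists_mem_of_ne_zero hS
    obtain ⟨T, rfl⟩ := Multiset.exists_cons_of_mem hl
    have lower : ∀ m U, wt (m ::ₘ U) < wt (l ::ₘ T) → ∀ a : ZHalf,
        IsAsymp (wt (l ::ₘ T)) 0 (fun d => (a : ℚ) * (extd d).ev (m ::ₘ U)) := fun m U h a =>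
      ((ih _ h Multiset.cons_ne_zero rfl).const_mul a).weaken h
    have main : IsAsymp (wt (l ::ₘ T)) (half ^ (2 * (l ::ₘ T).sum))
        (fun d => (2 * (d : ℚ) + 1) * (extd (d + l)).ev T) := by
      rcases eq_or_ne T 0 with rfl | hT
      · simpa [wt] using isAsymp_extd_zero l
      · have h := ((ih _ (by rw [wt_cons]; omega) hT rfl).comp_add l).linear_mul 1
        rw [← pow_add] at h
        refine h.congr (by rw [wt_cons]; ring) (by rw [Multiset.sum_cons]; ring_nf) fun d => ?_
        rw [Nat.cast_one]
    have h1 : IsAsymp (wt (l ::ₘ T)) 0 (fun d => (shift l (extd d)).ev T) := by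
      simp only [ev_shift]
      refine IsAsymp.multiset_sum T fun k hk => ?_
      have h2 := wt_erase hk
      have h3 := lower (k + l) (T.erase k) (by simp only [wt_cons]; omega)
        (((2 * k + 1 : ℕ)) : ZHalf)
      refine h3.congr rfl rfl fun d => ?_
      push_cast; rfl
    have h2 : IsAsymp (wt (l ::ₘ T)) 0 (fun d =>
        1 / 2 * ∑ i ∈ Finset.range l, (extd d).ev (i ::ₘ (l - 1 - i) ::ₘ T)) := by
      simp only [Finset.mul_sum]
      refine IsAsymp.finset_sum _ fun i hi => ?_
      have : i < l := by simpa using hi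
      exact lower i ((l - 1 - i) ::ₘ T) (by simp only [wt_cons]; omega) half
    have h3 : IsAsymp (wt (l ::ₘ T)) 0 (fun d =>
        ∑ i ∈ Finset.range l, (der i conn * der (l - 1 - i) (extd d)).ev T) := by
      refine IsAsymp.finset_sum _ fun i hi => ?_
      simp only [ev_mul]
      refine IsAsymp.multiset_sum _ fun p hp => ?_
      have hi' : i < l := by simpa using hi
      rw [Multiset.mem_antidiagonal] at hp
      have h4 := congrArg wt hp
      rw [wt_add] at h4
      exact lower (l - 1 - i) p.2 (by simp only [wt_cons]; omega) ⟨_, ev_conn_mem (i ::ₘ p.1)⟩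
    have h4 := ((h1.add main).add h2).add h3
    simp only [zero_add, add_zero] at h4
    exact h4.congr rfl rfl fun d => (extd_cons d l T).symm

end BGW

/-! ### Normalization, monicity and the quotient formulas. -/

namespace BGW

open Polynomial Corr

theorem card_le_wt (S : Multiset ℕ) : Multiset.card S ≤ wt S := by
  induction S using Multiset.induction with
  | empty => simp
  | cons d S ih => rw [Multiset.card_cons, wt_cons]; omega

/-- The correlators with one distinguished entry and at least one other entry. -/
theorem exists_polynomial_conn {S : Multiset ℕ} (hS : S ≠ 0) :
    ∃ q : ZHalf[X], q.natDegree ≤ wt S + (if Multiset.card S = 1 then 1 else 0) - 2 ∧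
      q.coeff (wt S + (if Multiset.card S = 1 then 1 else 0) - 2) = half ^ (2 * S.sum) ∧
      ∀ d : ℕ, ((2 * d + 1 + wt S : ℕ) : ℚ) ^ (if Multiset.card S = 1 then 1 else 0)
          * conn.ev (d ::ₘ S) = growth d * aeval (2 * (d : ℚ)) q * recip d := by
  by_cases hc : Multiset.card S = 1
  · obtain ⟨m, rfl⟩ := Multiset.card_eq_one.1 hc
    have hw : wt {m} = 2 * m + 1 := by simp [wt]
    obtain ⟨q, h1, h2, h3⟩ :=
      -- The factor 2d+2m+2 is X; it vanishes at d = -1-m, the only negative d with a nonzero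
      -- two-point value.
      ((isAsymp_extd hS).linear_mul (2 * m + 2)).exists_polynomial (by omega) fun k => by
        change _ * (if ({m} : Multiset ℕ) = 0 ∧ k = 0 then -1
          else if ({m} : Multiset ℕ) = {k} then 2 * (k : ℚ) + 1 else 0) = 0
        rw [if_neg (by simp)]
        split_ifs with h
        · obtain rfl := Multiset.singleton_inj.1 h
          rw [Int.cast_negSucc]; push_cast; ring
        · rw [mul_zero]
    refine ⟨q, by rwa [if_pos hc], by rwa [if_pos hc], fun d => ?_⟩
    have h4 := h3 d
    rw [Int.cast_natCast, extd_natCast, ev_der] at h4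
    rw [if_pos hc, ← h4, hw]
    push_cast
    ring
  · have hcard : 2 ≤ Multiset.card S := by
      have := Multiset.card_pos.2 hS
      omega
    have hw : 2 ≤ wt S := hcard.trans (card_le_wt S)
    obtain ⟨q, h1, h2, h3⟩ := (isAsymp_extd hS).exists_polynomial hw fun k => by
      change (if S = 0 ∧ k = 0 then -1 else if S = {k} then 2 * (k : ℚ) + 1 else 0) = 0
      rw [if_neg (by simp [hS]), if_neg]
      rintro rfl
      simp at hc
    refine ⟨q, by rwa [if_neg hc], by rwa [if_neg hc], fun d => ?_⟩
    have h4 := h3 d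
    rw [Int.cast_natCast, extd_natCast, ev_der] at h4
    rw [if_neg hc, pow_zero, one_mul, h4]

/-- The factor `(2d+1)!!³ / (2^(d+1) d!)`. -/
def factor (d : ℕ) : ℚ := ((2 * d + 1)‼ : ℚ) ^ 3 / (2 ^ (d + 1) * (d ! : ℚ))

theorem factor_pos (d : ℕ) : 0 < factor d := by
  have h1 := Nat.doubleFactorial_pos (2 * d + 1)
  have h2 := Nat.factorial_pos d
  unfold factor
  positivity

theorem growth_mul_recip (d : ℕ) : 2 ^ (2 * d + 1) * (growth d * recip d) = factor d := by
  rw [growth_natCast, recip_natCast, factor, show (4 : ℚ) = 2 ^ 2 by norm_num, ← pow_mul]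
  have h2 : (d ! : ℚ) ≠ 0 := Nat.cast_ne_zero.2 (Nat.factorial_ne_zero d)
  field_simp
  ring

theorem factor_succ (d : ℕ) :
    factor (d + 1) * (2 * d + 2) = factor d * (2 * d + 3) ^ 3 := by
  have h := growth_add_one d
  have h2 := recip_eq d
  rw [← growth_mul_recip, ← growth_mul_recip, h2]
  push_cast at h ⊢
  rw [h]
  ring

theorem factor_sub_div (e : ℕ) {s : ℕ} (hs : s ≤ e) :
    factor (e - s) / factor e = ∏ i ∈ Finset.Icc 1 s,
      (2 * ((e + 1 : ℕ) : ℚ) - 2 * i) / (2 * ((e + 1 : ℕ) : ℚ) - 2 * i + 1) ^ 3 := by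
  induction s with
  | zero => simp [(factor_pos e).ne']
  | succ s ih =>
    rw [Finset.prod_Icc_succ_top (by omega), ← ih (by omega)]
    obtain ⟨m, rfl⟩ : ∃ m, e = m + (s + 1) := ⟨e - (s + 1), by omega⟩
    rw [show m + (s + 1) - s = m + 1 by omega, Nat.add_sub_cancel]
    have h := factor_succ m
    have h1 : 2 * ((m + (s + 1) + 1 : ℕ) : ℚ) - 2 * ((s + 1 : ℕ) : ℚ) = 2 * m + 2 := by
      push_cast; ring
    rw [h1]
    have h2 : (2 * (m : ℚ) + 2 + 1) ≠ 0 := by positivity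
    have h3 := (factor_pos (m + (s + 1))).ne'
    rw [div_mul_div_comm, div_eq_div_iff h3 (mul_ne_zero h3 (pow_ne_zero _ h2))]
    linear_combination - factor (m + (s + 1)) * h

theorem C_eq (ds : List ℕ) : C ds = 2 ^ (2 * genus ds - 1) * B ds / ((X ds - 1)! : ℚ) := by
  have h : (ds.map fun d => ((2 * d + 1)‼ : ℚ)).prod ≠ 0 := by
    refine List.prod_ne_zero fun h0 => ?_
    obtain ⟨d, _, hd⟩ := List.mem_map.1 h0
    exact (Nat.doubleFactorial_pos (2 * d + 1)).ne' (Nat.cast_eq_zero.1 hd)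
  rw [C, number]
  field_simp

theorem X_append_singleton (lam : List ℕ) (d : ℕ) :
    X (lam ++ [d]) = 2 * d + 1 + wt (lam : Multiset ℕ) := by
  simp [X, wt, add_comm]

theorem C_singleton (e : ℕ) : C [e] = factor e / ((2 * e + 2)! : ℚ) := by
  rw [C_eq, B_eq_conn (by simp), ← growth_mul_recip]
  have h := one_point e
  have h1 := recip_eq e
  have h2 : genus [e] = e + 1 := by simp [genus]
  have h3 : X [e] = 2 * e + 1 := X_cons e []
  rw [h2, h3, h1, Multiset.coe_singleton, show 2 * (e + 1) - 1 = 2 * e + 1 by omega,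
    Nat.add_sub_cancel, Nat.factorial_succ, Nat.factorial_succ]
  have h4 : ((2 * e)! : ℚ) ≠ 0 := Nat.cast_ne_zero.2 (Nat.factorial_ne_zero _)
  have h5 : (2 * (e : ℚ) + 1) ≠ 0 := by positivity
  have h6 : (2 * (e : ℚ) + 2) ≠ 0 := by positivity
  have h7 : conn.ev {e} = growth e * recip (e + 1) / (2 * (e : ℚ) + 1) := by
    rw [← h]; field_simp
  rw [h7]
  push_cast
  rw [show 2 * (e : ℚ) + 1 + 1 = 2 * e + 2 by ring]
  field_simp

theorem exists_monic_polynomial {lam : List ℕ} (hlam : lam ≠ []) :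
    ∃ P : ZHalf[X], P.Monic ∧
      P.natDegree + 2 = (lam.map fun a => 2 * a + 1).sum + (if lam.length + 1 = 2 then 1 else 0) ∧
      ∀ d : ℕ, C (lam ++ [d]) =
        1 / ((X (lam ++ [d]) : ℚ) ^ (if lam.length + 1 = 2 then 1 else 0)
            * ((X (lam ++ [d]) - 1)! : ℚ)) * factor d * aeval (X (lam ++ [d]) : ℚ) P := by
  have hS : (lam : Multiset ℕ) ≠ 0 := by simpa using hlam
  obtain ⟨q, h1, h2, h3⟩ := exists_polynomial_conn hS
  have hw : wt (lam : Multiset ℕ) = (lam.map fun a => 2 * a + 1).sum := by simp [wt]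
  have hδ : (if Multiset.card (lam : Multiset ℕ) = 1 then 1 else 0)
      = if lam.length + 1 = 2 then 1 else 0 := if_congr (by simp) rfl rfl
  rw [hδ] at h1 h2
  simp only [hδ] at h3
  set δ : ℕ := if lam.length + 1 = 2 then 1 else 0 with hδ'
  set N := wt (lam : Multiset ℕ) + δ - 2 with hN
  have hN2 : N + 2 = wt (lam : Multiset ℕ) + δ := by
    have hlen := card_le_wt (lam : Multiset ℕ)
    rw [Multiset.coe_card] at hlen
    have : 1 ≤ lam.length := List.length_pos_iff.2 hlam
    split_ifs at hδ' <;> omega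
  set w : ℕ := wt (lam : Multiset ℕ)
  -- The change of variable is 2d = X - (w+1). The power of 2 is what remains of 2^(2g-1) once
  -- 2^(2d+1) has gone into `factor`, and it makes `P` monic.
  set P : ZHalf[X] := Polynomial.C (2 ^ (2 * lam.sum)) * taylor (-((w + 1 : ℕ) : ZHalf)) q with hP
  have hdeg : P.natDegree ≤ N :=
    (natDegree_C_mul_le _ _).trans (by rwa [natDegree_taylor])
  have hcoeff : P.coeff N = 1 := by
    have h4 : (2 : ZHalf) * half = 1 := Subtype.ext (by
      change (2 : ℚ) * (1 / 2) = 1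
      norm_num)
    rw [hP, coeff_C_mul, coeff_taylor_of_natDegree_le h1, h2, Multiset.sum_coe, ← mul_pow, h4,
      one_pow]
  refine ⟨P, monic_of_natDegree_le_of_coeff_eq_one N hdeg hcoeff, ?_, fun d => ?_⟩
  · rw [natDegree_eq_of_le_of_coeff_ne_zero hdeg (by rw [hcoeff]; exact one_ne_zero), hN2, hw]
  · have h4 := h3 d
    have h5 : aeval (X (lam ++ [d]) : ℚ) P = 2 ^ (2 * lam.sum) * aeval (2 * (d : ℚ)) q := by
      have hx : (X (lam ++ [d]) : ℚ) = 2 * d + 1 + w := by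
        rw [X_append_singleton]; push_cast; rfl
      have h2' : algebraMap ZHalf ℚ 2 = 2 := map_ofNat _ 2
      rw [hP, map_mul, aeval_C, aeval_taylor, hx, map_pow, map_neg, map_natCast, h2']
      congr 2
      push_cast; ring_nf
    have h6 : (X (lam ++ [d]) : ℚ) ≠ 0 := by
      rw [X_append_singleton]; positivity
    have h7 : ((X (lam ++ [d]) - 1)! : ℚ) ≠ 0 := Nat.cast_ne_zero.2 (Nat.factorial_ne_zero _)
    have h8 : (↑(lam ++ [d]) : Multiset ℕ) = d ::ₘ (lam : Multiset ℕ) := by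
      rw [← Multiset.coe_add, add_comm, Multiset.coe_singleton, Multiset.singleton_add]
    have h9 : 2 * genus (lam ++ [d]) - 1 = 2 * lam.sum + (2 * d + 1) := by
      simp [genus]; omega
    rw [← X_append_singleton] at h4
    rw [C_eq, B_eq_conn (by simp), h8, h9, pow_add, h5, ← growth_mul_recip]
    field_simp
    linear_combination h4

theorem factorial_add_eq (a m : ℕ) :
    ((a + m)! : ℚ) = (a ! : ℚ) * ∏ j ∈ Finset.Icc 1 m, ((a : ℚ) + j) := by
  induction m with
  | zero => simp
  | succ m ih =>
    rw [Finset.prod_Icc_succ_top (by omega), ← mul_assoc, ← ih, ← add_assoc, Nat.factorial_succ]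
    push_cast; ring

theorem C_div_C {lam : List ℕ} {P : ZHalf[X]} {g : ℕ} (hg : lam.sum + 1 ≤ g) (hlam : lam ≠ [])
    (hP : ∀ d : ℕ, C (lam ++ [d]) =
        1 / ((X (lam ++ [d]) : ℚ) ^ (if lam.length + 1 = 2 then 1 else 0)
            * ((X (lam ++ [d]) - 1)! : ℚ)) * factor d * aeval (X (lam ++ [d]) : ℚ) P) :
    C (lam ++ [g - 1 - lam.sum]) / C [g - 1] =
      aeval (2 * (g : ℚ) - 2 + (lam.length + 1 : ℕ)) P
        / (∏ j ∈ Finset.Icc 1 (lam.length + 1 - 3), (2 * (g : ℚ) + j))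
        * ∏ i ∈ Finset.Icc 1 lam.sum, (2 * (g : ℚ) - 2 * i) / (2 * (g : ℚ) - 2 * i + 1) ^ 3 := by
  obtain ⟨e, rfl⟩ : ∃ e, g = e + 1 := ⟨g - 1, by omega⟩
  rw [Nat.add_sub_cancel, hP, C_singleton, ← factor_sub_div e (by omega)]
  have hX : X (lam ++ [e - lam.sum]) = 2 * e + 1 + lam.length := by
    have h1 : ∀ l : List ℕ, (l.map fun d => 2 * d + 1).sum = 2 * l.sum + l.length := by
      intro l
      induction l with
      | nil => rfl
      | cons a l ih => simp only [List.map_cons, List.sum_cons, List.length_cons, ih]; ring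
    rw [X, h1]
    simp only [List.sum_append, List.sum_singleton, List.length_append, List.length_singleton]
    omega
  -- With g = e+1 and X = 2g-2+n: for n = 2, X·(X-1)! = (2g)!, and for n ≥ 3, (X-1)! = (2g+n-3)!.
  have hfac : ((2 * e + 1 + lam.length : ℕ) : ℚ) ^ (if lam.length + 1 = 2 then 1 else 0)
        * ((2 * e + 1 + lam.length - 1)! : ℚ)
      = ((2 * e + 2)! : ℚ)
        * ∏ j ∈ Finset.Icc 1 (lam.length + 1 - 3), (2 * ((e + 1 : ℕ) : ℚ) + j) := by
    have hl : 1 ≤ lam.length := List.length_pos_iff.2 hlam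
    by_cases h2 : lam.length + 1 = 2
    · obtain h3 : lam.length = 1 := by omega
      rw [if_pos h2, h3]
      simp [Nat.factorial_succ]
    · obtain ⟨m, hm⟩ : ∃ m, lam.length = m + 2 := ⟨lam.length - 2, by omega⟩
      rw [if_neg h2, hm, show 2 * e + 1 + (m + 2) - 1 = (2 * e + 2) + m by omega, factorial_add_eq]
      simp
      left
      refine Finset.prod_congr rfl fun j _ => ?_
      ring
  have hx : ((2 * e + 1 + lam.length : ℕ) : ℚ)
      = 2 * ((e + 1 : ℕ) : ℚ) - 2 + ((lam.length + 1 : ℕ) : ℚ) := by push_cast; ring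
  rw [hX, hfac, hx]
  have h4 : ((2 * e + 2)! : ℚ) ≠ 0 := Nat.cast_ne_zero.2 (Nat.factorial_ne_zero _)
  have h5 : ∏ j ∈ Finset.Icc 1 (lam.length + 1 - 3), (2 * ((e + 1 : ℕ) : ℚ) + j) ≠ 0 :=
    Finset.prod_ne_zero_iff.2 fun j _ => by positivity
  have h6 := (factor_pos e).ne'
  field_simp

theorem ascPochhammer_eval_sub (s m : ℕ) (y : ℚ) :
    (ascPochhammer ℚ (2 * s + m)).eval (y - 2 * s) =
      (∏ i ∈ Finset.Icc 1 s, (y - 2 * i) * (y - 2 * i + 1)) * (ascPochhammer ℚ m).eval y := by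
  induction s with
  | zero => simp
  | succ s ih =>
    rw [Finset.prod_Icc_succ_top (by omega), show 2 * (s + 1) + m = 2 * s + m + 1 + 1 by ring,
      ascPochhammer_succ_left, ascPochhammer_succ_left]
    simp only [eval_mul, eval_X, eval_comp, eval_add, eval_one]
    rw [show y - 2 * ((s + 1 : ℕ) : ℚ) + 1 + 1 = y - 2 * s by push_cast; ring, ih]
    ring

theorem ascPochhammer_eval_succ (m : ℕ) (y : ℚ) :
    (ascPochhammer ℚ (m + 1)).eval y = y * ∏ j ∈ Finset.Icc 1 m, (y + j) := by
  induction m with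
  | zero => simp
  | succ m ih =>
    rw [ascPochhammer_succ_eval, ih, Finset.prod_Icc_succ_top (by omega)]; ring

/-- For n ≥ 2 the Pochhammer product consists of the pairs (2x-2i)(2x-2i+1), 1 ≤ i ≤ s+1, followed
by 2x, …, 2x+n-3, so it contains every factor to be cleared; `T` is the cofactor. -/
theorem exists_pochhammer_factor {n : ℕ} (hn : 1 ≤ n) {s : ℕ} (hs : n = 1 → s = 0) :
    ∃ T : ZHalf[X], ∀ x : ℚ,
      (ascPochhammer ℚ (2 * s + n)).eval (2 * x - 2 * s - 2)
          * ∏ i ∈ Finset.Icc 1 s, (2 * x - 2 * i)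
        = aeval x T * (∏ j ∈ Finset.Icc 1 (n - 3), (2 * x + j))
          * ∏ i ∈ Finset.Icc 1 s, (2 * x - 2 * i + 1) := by
  have h2 : algebraMap ZHalf ℚ 2 = 2 := map_ofNat _ 2
  rcases eq_or_ne n 1 with rfl | h1
  · refine ⟨Polynomial.C 2 * Polynomial.X - Polynomial.C 2, fun x => ?_⟩
    obtain rfl := hs rfl
    simp [h2]
  · obtain ⟨m, rfl⟩ : ∃ m, n = m + 2 := ⟨n - 2, by omega⟩
    have key : ∀ x : ℚ, (ascPochhammer ℚ (2 * s + (m + 2))).eval (2 * x - 2 * s - 2)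
        = (∏ i ∈ Finset.Icc 1 s, (2 * x - 2 * i) * (2 * x - 2 * i + 1))
          * ((2 * x - 2 * (s + 1)) * (2 * x - 2 * (s + 1) + 1))
          * (ascPochhammer ℚ m).eval (2 * x) := by
      intro x
      have := ascPochhammer_eval_sub (s + 1) m (2 * x)
      rw [Finset.prod_Icc_succ_top (by omega)] at this
      push_cast at this
      rw [← this, show 2 * (s + 1) + m = 2 * s + (m + 2) by ring,
        show 2 * x - 2 * ((s : ℚ) + 1) = 2 * x - 2 * s - 2 by ring]
    set L : ℕ → ZHalf[X] :=
      fun k => Polynomial.C 2 * Polynomial.X - Polynomial.C ((k : ℕ) : ZHalf) with hL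
    have hLa : ∀ k x, aeval (x : ℚ) (L k) = 2 * x - k := by
      intro k x
      simp only [hL, map_sub, map_mul, aeval_C, aeval_X, h2, map_natCast]
    refine ⟨(∏ i ∈ Finset.Icc 1 s, L (2 * i) ^ 2) * (L (2 * (s + 1)) * L (2 * s + 1))
      * if m = 0 then 1 else Polynomial.C 2 * Polynomial.X, fun x => ?_⟩
    rw [key, map_mul, map_mul, map_mul, map_prod, Finset.prod_mul_distrib]
    simp only [map_pow, hLa, Finset.prod_pow]
    rcases m with _ | m
    · simp
      ring
    · rw [ascPochhammer_eval_succ, if_neg (Nat.succ_ne_zero m), map_mul, aeval_C, aeval_X, h2,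
        show m + 1 + 2 - 3 = m by omega]
      push_cast
      ring

end BGW

theorem proposition4p3 (n : ℕ) (lam : List ℕ) (hlen : lam.length + 1 = n)
    (hpos : ∀ a ∈ lam, 1 ≤ a) :
    ∃ P Q R : Polynomial BGW.ZHalf,
      P.Monic ∧
      -- the formula for `C(λ, dₙ)` and the degree of `P`, for `n ≥ 2`
      (2 ≤ n →
        P.natDegree + 2 = (lam.map fun a => 2 * a + 1).sum + (if n = 2 then 1 else 0) ∧
        ∀ d : ℕ,
          BGW.C (lam ++ [d]) =
            1 / ((BGW.X (lam ++ [d]) : ℚ) ^ (if n = 2 then 1 else 0)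
                  * ((BGW.X (lam ++ [d]) - 1)! : ℚ))
              * (((2 * d + 1)‼ : ℚ) ^ 3 / (2 ^ (d + 1) * (d ! : ℚ)))
              * Polynomial.aeval (BGW.X (lam ++ [d]) : ℚ) P) ∧
      -- `C(λ, g-1-|λ|) / C(g-1)` as an explicit rational function of `g`
      (∀ x : ℚ, Polynomial.aeval x Q = Polynomial.aeval (2 * x - 2 + n) P) ∧
      (∀ g : ℕ, lam.sum + 1 ≤ g →
        BGW.C [g - 1] ≠ 0 ∧
        BGW.C (lam ++ [g - 1 - lam.sum]) / BGW.C [g - 1] =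
          Polynomial.aeval (g : ℚ) Q / (∏ j ∈ Finset.Icc 1 (n - 3), (2 * (g : ℚ) + j))
            * ∏ i ∈ Finset.Icc 1 lam.sum,
                (2 * (g : ℚ) - 2 * i) / (2 * (g : ℚ) - 2 * i + 1) ^ 3) ∧
      -- the form with Pochhammer denominator, which is nonzero for `g ≥ |λ| + 2`
      (∀ g : ℕ, lam.sum + 2 ≤ g →
        BGW.C (lam ++ [g - 1 - lam.sum]) / BGW.C [g - 1] =
          Polynomial.aeval (g : ℚ) R /
            ((ascPochhammer ℚ (2 * lam.sum + n)).eval (2 * (g : ℚ) - 2 * lam.sum - 2)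
              * ∏ i ∈ Finset.Icc 1 lam.sum, (2 * (g : ℚ) - 2 * i + 1) ^ 2)) := by
  subst hlen
  have hC : ∀ e, BGW.C [e] ≠ 0 := fun e => by
    rw [BGW.C_singleton]
    exact div_ne_zero (BGW.factor_pos e).ne' (Nat.cast_ne_zero.2 (Nat.factorial_ne_zero _))
  obtain ⟨P, hmonic, hdeg, hdiv⟩ : ∃ P : Polynomial BGW.ZHalf, P.Monic ∧
      (2 ≤ lam.length + 1 →
        P.natDegree + 2
            = (lam.map fun a => 2 * a + 1).sum + (if lam.length + 1 = 2 then 1 else 0) ∧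
        ∀ d : ℕ,
          BGW.C (lam ++ [d]) =
            1 / ((BGW.X (lam ++ [d]) : ℚ) ^ (if lam.length + 1 = 2 then 1 else 0)
                  * ((BGW.X (lam ++ [d]) - 1)! : ℚ))
              * BGW.factor d
              * Polynomial.aeval (BGW.X (lam ++ [d]) : ℚ) P) ∧
      (∀ g : ℕ, lam.sum + 1 ≤ g →
        BGW.C (lam ++ [g - 1 - lam.sum]) / BGW.C [g - 1] =
          Polynomial.aeval (2 * (g : ℚ) - 2 + (lam.length + 1 : ℕ)) P
            / (∏ j ∈ Finset.Icc 1 (lam.length + 1 - 3), (2 * (g : ℚ) + j))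
            * ∏ i ∈ Finset.Icc 1 lam.sum,
                (2 * (g : ℚ) - 2 * i) / (2 * (g : ℚ) - 2 * i + 1) ^ 3) := by
    rcases eq_or_ne lam [] with rfl | hlam
    -- For n = 1 both sides of the quotient formula are 1.
    · exact ⟨1, Polynomial.monic_one, fun h => absurd h (by simp),
        fun g _ => by simp [div_self (hC (g - 1))]⟩
    · obtain ⟨P, h1, h2, h3⟩ := BGW.exists_monic_polynomial hlam
      exact ⟨P, h1, fun _ => ⟨h2, h3⟩, fun g hg => BGW.C_div_C hg hlam h3⟩
  obtain ⟨T, hT⟩ := BGW.exists_pochhammer_factor (n := lam.length + 1) (by omega) (s := lam.sum)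
    fun h => by rw [List.length_eq_zero_iff.1 (by omega : lam.length = 0), List.sum_nil]
  set Q : Polynomial BGW.ZHalf := P.comp (Polynomial.C 2 * Polynomial.X
    + Polynomial.C (((lam.length + 1 : ℕ) : BGW.ZHalf) - 2)) with hQ
  have hQa : ∀ x : ℚ, Polynomial.aeval x Q
      = Polynomial.aeval (2 * x - 2 + (lam.length + 1 : ℕ)) P := by
    intro x
    have h2 : algebraMap BGW.ZHalf ℚ 2 = 2 := map_ofNat _ 2
    rw [hQ, Polynomial.aeval_comp]
    congr 2
    simp only [map_add, map_mul, map_sub, Polynomial.aeval_C, Polynomial.aeval_X, h2,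
      map_natCast]
    ring
  refine ⟨P, Q, Q * T, hmonic, hdeg, hQa, fun g hg => ⟨hC _, by rw [hQa]; exact hdiv g hg⟩,
    fun g hg => ?_⟩
  rw [hdiv g (by omega), ← hQa, map_mul, Finset.prod_div_distrib, Finset.prod_pow,
    Finset.prod_pow]
  have hodd : ∏ i ∈ Finset.Icc 1 lam.sum, (2 * (g : ℚ) - 2 * i + 1) ≠ 0 := by
    refine Finset.prod_ne_zero_iff.2 fun i hi => ?_
    have h1 : (i : ℚ) ≤ g := by
      have := (Finset.mem_Icc.1 hi).2
      exact_mod_cast (by omega : i ≤ g)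
    linarith
  have hD : ∏ j ∈ Finset.Icc 1 (lam.length + 1 - 3), (2 * (g : ℚ) + j) ≠ 0 := by
    refine Finset.prod_ne_zero_iff.2 fun j hj => ?_
    have : 0 < g := by omega
    positivity
  have hpoch : (ascPochhammer ℚ (2 * lam.sum + (lam.length + 1))).eval
      (2 * (g : ℚ) - 2 * lam.sum - 2) ≠ 0 := by
    -- Here g ≥ |λ|+2 is essential: at g = |λ|+1 the first Pochhammer factor is zero.
    refine (ascPochhammer_pos _ _ ?_).ne'
    have : (lam.sum : ℚ) + 2 ≤ g := by exact_mod_cast hg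
    linarith
  have alg : ∀ q t p e o D : ℚ, o ≠ 0 → D ≠ 0 → p ≠ 0 → p * e = t * D * o →
      q / D * (e / o ^ 3) = q * t / (p * o ^ 2) := by
    intro q t p e o D ho hD hp h
    field_simp
    linear_combination q * h
  exact alg _ _ _ _ _ _ hodd hD hpoch (hT g)
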